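/- Let $U$ be a unit interval order: a finite poset isomorphic to a finite subset of $\mathbb R$ ordered by $u\succ w$ iff $u\ge w+1$. Let $G=\mathrm{inc}(U)$ be its incomparability graph (vertices: the elements of $U$; edges: the pairs of incomparable elements). Regard the elements of $U$ as commuting variables, and for $k\ge 1$ put $e_k^U=\sum_{S}\prod_{v\in S}v$, the sum over all $k$-element stable sets $S$ of $G$. Let $\Lambda$ be the ring of symmetric functions (with real coefficients) in infinitely many variables $x_i$, let $f\mapsto f^U$ be the algebra homomorphism $\Lambda\to\mathbb R[U]$ with $e_k\mapsto e_k^U$ for all $k\ge1$, and let $m_{l,1}^U$ be the image of the monomial symmetric function $m_{(l,1)}$, which is the sum of all distinct monomials whose exponents are $l$ and $1$. A sequence $\vec w=(w_1,\dots,w_l)$ in $U$ is called correct if $w_i\not\succ w_{i+1}$ for $1\le i<l$, and for each $2\le j\le l$ there is $i<j$ with $w_i\not\prec w_j$. (1) For every $l\ge 2$, $$m^U_{l,1}=\sum_{(\vec w,z)\in M^U_{l,1}}w_1\cdots w_l\cdot z,$$ where $M^U_{l,1}$ is the set of pairs $(\vec w,z)$ of a correct sequence $\vec w$ of length $l$ and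 an element $z\in U$ such that either $z\succ w_i$ for all $i=1,\dots,l$, or $z\prec w_l$. (2) For every $l\ge1$, $m^U_{l,1}$ is monomial-positive, i.e. $m^U_{l,1}\in\mathbb N[U]$. (3) If $n=|U|\ge2$ and $X_{G}=\sum_\lambda c_\lambda e_\lambda$ is the expansion in the basis $(e_\lambda)$ of $\Lambda$ of the chromatic symmetric function $X_G=\sum_c\prod_{v\in U}x_{c(v)}$ (sum over all proper colorings $c$ of $G$ by the indices of the variables), then $c_{n-1,1}\ge0$. -/

import Mathlib

namespace ChromaticSymm

/-! ### The ring of symmetric functions in the variables `x₀, x₁, x₂, …` -/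

/-- The ring `Λ` of symmetric functions in infinitely many variables (with real coefficients): the
formal power series of bounded degree that are invariant under all permutations of the variables. -/
noncomputable def Lam : Subalgebra ℝ (MvPowerSeries ℕ ℝ) where
  carrier := {f | (∃ N : ℕ, ∀ d : ℕ →₀ ℕ, N < d.degree → MvPowerSeries.coeff d f = 0) ∧
    ∀ σ : Equiv.Perm ℕ, MvPowerSeries.rename σ f = f}
  mul_mem' := by
    rintro f g ⟨⟨N, hN⟩, hf⟩ ⟨⟨M, hM⟩, hg⟩
    refine ⟨⟨N + M, fun d hd => ?_⟩, fun σ => by rw [map_mul, hf, hg]⟩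
    rw [MvPowerSeries.coeff_mul]
    refine Finset.sum_eq_zero fun p hp => ?_
    rw [Finset.HasAntidiagonal.mem_antidiagonal] at hp
    rw [← hp, map_add] at hd
    by_cases h : N < p.1.degree
    · rw [hN _ h, zero_mul]
    · rw [hM _ (by omega), mul_zero]
  add_mem' := by
    rintro f g ⟨⟨N, hN⟩, hf⟩ ⟨⟨M, hM⟩, hg⟩
    refine ⟨⟨N + M, fun d hd => ?_⟩, fun σ => by rw [map_add, hf, hg]⟩
    rw [map_add, hN _ (by omega), hM _ (by omega), add_zero]
  algebraMap_mem' := by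
    intro r
    refine ⟨⟨0, fun d hd => ?_⟩, fun σ => AlgHom.commutes _ r⟩
    rw [MvPowerSeries.algebraMap_apply, MvPowerSeries.coeff_C, if_neg]
    rintro rfl
    simp at hd

/-- Invariance under permutations, read off on the coefficients. -/
theorem rename_eq_self {f : MvPowerSeries ℕ ℝ}
    (h : ∀ (σ : Equiv.Perm ℕ) (d : ℕ →₀ ℕ),
      MvPowerSeries.coeff (d.embDomain σ.toEmbedding) f = MvPowerSeries.coeff d f)
    (σ : Equiv.Perm ℕ) : MvPowerSeries.rename σ f = f := by
  ext d
  have hd : d = (d.embDomain σ.symm.toEmbedding).embDomain σ.toEmbedding := by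
    simp only [Finsupp.embDomain_eq_mapDomain, ← Finsupp.mapDomain_comp]
    simp
  have h1 := MvPowerSeries.coeff_embDomain_rename σ.toEmbedding f
    (d.embDomain σ.symm.toEmbedding)
  rw [← hd, h σ.symm d] at h1
  exact h1

theorem coeff_embDomain_of_mem {f : MvPowerSeries ℕ ℝ} (hf : f ∈ Lam) (σ : Equiv.Perm ℕ)
    (d : ℕ →₀ ℕ) :
    MvPowerSeries.coeff (d.embDomain σ.toEmbedding) f = MvPowerSeries.coeff d f := by
  have h1 := MvPowerSeries.coeff_embDomain_rename σ.toEmbedding f d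
  have h2 : MvPowerSeries.rename σ.toEmbedding f = f := hf.2 σ
  rwa [h2] at h1

open Classical in
/-- The elementary symmetric function `e_k`: the sum of all squarefree monomials of degree `k`. -/
noncomputable def elem (k : ℕ) : Lam :=
  ⟨fun d => if d.degree = k ∧ ∀ i, d i ≤ 1 then 1 else 0, by
    refine ⟨⟨k, fun d hd => if_neg fun h => by omega⟩, rename_eq_self fun σ d => ?_⟩
    have h1 : (d.embDomain σ.toEmbedding).degree = d.degree := by
      rw [Finsupp.embDomain_eq_mapDomain, Finsupp.degree_mapDomain]
    have h2 : (∀ i, d.embDomain σ.toEmbedding i ≤ 1) ↔ ∀ i, d i ≤ 1 := by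
      refine ⟨fun h i => ?_, fun h i => ?_⟩
      · simpa only [Finsupp.embDomain_apply_self] using h (σ.toEmbedding i)
      · obtain ⟨j, rfl⟩ : ∃ j, σ.toEmbedding j = i := σ.surjective i
        rw [Finsupp.embDomain_apply_self]
        exact h j
    exact if_congr (by rw [h1, h2]) rfl rfl⟩

/-- `e_λ`, the product of the `e_{λ_i}`. -/
noncomputable def elemPart {n : ℕ} (μ : n.Partition) : Lam := (μ.parts.map elem).prod

open Classical in
/-- The monomial symmetric function `m_λ`: the sum of all (distinct) monomials whose nonzero
exponents are, in some order and with multiplicity, the parts of `λ`. -/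
noncomputable def mono {n : ℕ} (μ : n.Partition) : Lam :=
  ⟨fun d => if d.support.val.map d = μ.parts then 1 else 0, by
    refine ⟨⟨n, fun d hd => if_neg fun h => ?_⟩, rename_eq_self fun σ d => ?_⟩
    · have h1 := congrArg Multiset.sum h
      rw [μ.parts_sum] at h1
      have h2 : d.degree = n := by rw [← h1]; rfl
      omega
    · have h1 : (d.embDomain σ.toEmbedding).support.val.map (d.embDomain σ.toEmbedding)
          = d.support.val.map d := by
        rw [Finsupp.support_embDomain, Finset.map_val, Multiset.map_map]
        refine Multiset.map_congr rfl fun i _ => ?_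
        exact Finsupp.embDomain_apply_self _ _ _
      exact if_congr (by rw [h1]) rfl rfl⟩

/-! ### `Λ` is the polynomial ring in `e₁, e₂, …` -/

/-- The evaluation of polynomials in `X₀, X₁, X₂, …` at `e₁, e₂, e₃, …`. -/
noncomputable def elemEval : MvPolynomial ℕ ℝ →ₐ[ℝ] Lam :=
  MvPolynomial.aeval fun i => elem (i + 1)

theorem killCompl_elem (m k : ℕ) :
    MvPowerSeries.killCompl (Fin.valEmbedding (n := m)) (elem k : MvPowerSeries ℕ ℝ)
      = (MvPolynomial.esymm (Fin m) ℝ k : MvPowerSeries (Fin m) ℝ) := by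
  classical
  ext d
  rw [MvPowerSeries.coeff_killCompl, MvPolynomial.coeff_coe, MvPolynomial.esymm_eq_sum_monomial,
    MvPolynomial.coeff_sum]
  simp only [MvPolynomial.coeff_monomial]
  have h1 : (d.embDomain Fin.valEmbedding).degree = d.degree := by
    rw [Finsupp.embDomain_eq_mapDomain, Finsupp.degree_mapDomain]
  have h2 : (∀ i, d.embDomain Fin.valEmbedding i ≤ 1) ↔ ∀ i, d i ≤ 1 := by
    refine ⟨fun h i => ?_, fun h i => ?_⟩
    · simpa only [Finsupp.embDomain_apply_self] using h (Fin.valEmbedding i)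
    · by_cases hi : i ∈ Set.range (Fin.valEmbedding (n := m))
      · obtain ⟨j, rfl⟩ := hi
        rw [Finsupp.embDomain_apply_self]
        exact h j
      · rw [Finsupp.embDomain_of_notMem_range _ _ _ hi]
        exact zero_le_one
  have h3 : MvPowerSeries.coeff (d.embDomain Fin.valEmbedding) (elem k : MvPowerSeries ℕ ℝ)
      = if d.degree = k ∧ ∀ i, d i ≤ 1 then 1 else 0 := by
    exact if_congr (by rw [h1, h2]) rfl rfl
  have happ : ∀ (t : Finset (Fin m)) (i : Fin m),
      (∑ j ∈ t, Finsupp.single j 1 : Fin m →₀ ℕ) i = if i ∈ t then 1 else 0 := by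
    intro t i
    rw [Finsupp.finsetSum_apply]
    simp [Finsupp.single_apply]
  rw [h3]
  split_ifs with h
  · have hd : (∑ j ∈ d.support, Finsupp.single j 1 : Fin m →₀ ℕ) = d := by
      ext i
      rw [happ]
      have := h.2 i
      split_ifs with hi
      · have := Finsupp.mem_support_iff.1 hi
        omega
      · exact (Finsupp.notMem_support_iff.1 hi).symm
    have hc : d.support.card = k := by
      rw [← h.1]
      conv_rhs => rw [← hd]
      rw [map_sum]
      simp
    rw [Finset.sum_eq_single d.support, if_pos hd]
    · intro t _ ht
      refine if_neg fun h' => ht ?_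
      ext i
      rw [Finsupp.mem_support_iff, ← h', happ]
      simp
    · intro h'
      exact absurd (Finset.mem_powersetCard.2 ⟨Finset.subset_univ _, hc⟩) h'
  · symm
    refine Finset.sum_eq_zero fun t ht => if_neg fun h' => h ?_
    rw [← h']
    refine ⟨?_, fun i => ?_⟩
    · rw [map_sum]
      simpa using (Finset.mem_powersetCard.1 ht).2
    · rw [happ]
      split_ifs <;> omega

theorem killCompl_elemEval (m : ℕ) (Q : MvPolynomial (Fin m) ℝ) :
    MvPowerSeries.killCompl (Fin.valEmbedding (n := m))
        (elemEval (MvPolynomial.rename Fin.val Q) : MvPowerSeries ℕ ℝ)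
      = ((MvPolynomial.esymmAlgHom (Fin m) ℝ m Q : MvPolynomial (Fin m) ℝ) :
          MvPowerSeries (Fin m) ℝ) := by
  have key : ((MvPowerSeries.killCompl (Fin.valEmbedding (n := m))).comp
      (Lam.val.comp (elemEval.comp (MvPolynomial.rename Fin.val)))) =
      ((MvPolynomial.coeToMvPowerSeries.algHom ℝ).comp
        ((MvPolynomial.symmetricSubalgebra (Fin m) ℝ).val.comp
          (MvPolynomial.esymmAlgHom (Fin m) ℝ m))) := by
    refine MvPolynomial.algHom_ext fun i => ?_
    simp only [AlgHom.comp_apply, MvPolynomial.rename_X, elemEval, MvPolynomial.aeval_X,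
      MvPolynomial.esymmAlgHom, Subalgebra.coe_val, MvPolynomial.coeToMvPowerSeries.algHom_apply,
      killCompl_elem]
    simp
  have := DFunLike.congr_fun key Q
  simpa using this

theorem elemEval_injective : Function.Injective elemEval := by
  rw [injective_iff_map_eq_zero]
  intro P hP
  obtain ⟨m, hm⟩ : ∃ m : ℕ, ∀ i ∈ P.vars, i < m :=
    ⟨P.vars.sup id + 1, fun i hi => Nat.lt_succ_of_le (Finset.le_sup (f := id) hi)⟩
  obtain ⟨Q, rfl⟩ := MvPolynomial.exists_rename_eq_of_vars_subset_range P (Fin.val : Fin m → ℕ)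
    Fin.val_injective (fun i hi => ⟨⟨i, hm i hi⟩, rfl⟩)
  have h := killCompl_elemEval m Q
  rw [hP, ZeroMemClass.coe_zero, map_zero] at h
  have h2 : (MvPolynomial.esymmAlgHom (Fin m) ℝ m Q : MvPolynomial (Fin m) ℝ) = 0 :=
    MvPolynomial.coe_injective (Fin m) ℝ (by rw [← h, MvPolynomial.coe_zero])
  have h3 : MvPolynomial.esymmAlgHom (Fin m) ℝ m Q = 0 := Subtype.ext h2
  rw [(injective_iff_map_eq_zero _).1 (MvPolynomial.esymmAlgHom_fin_injective ℝ le_rfl) Q h3,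
    map_zero]

/-- A product of the `e_{i+1}` is homogeneous. -/
theorem coeff_elemEval_monomial (s : ℕ →₀ ℕ) (r : ℝ) (d : ℕ →₀ ℕ)
    (hd : d.degree ≠ s.sum fun i a => a * (i + 1)) :
    MvPowerSeries.coeff d (elemEval (MvPolynomial.monomial s r) : MvPowerSeries ℕ ℝ) = 0 := by
  classical
  induction s using Finsupp.induction_linear generalizing d r with
  | zero =>
    have h : (elemEval (MvPolynomial.monomial 0 r) : MvPowerSeries ℕ ℝ)
        = algebraMap ℝ (MvPowerSeries ℕ ℝ) r := by
      rw [← MvPolynomial.C_apply, ← MvPolynomial.algebraMap_eq, AlgHom.commutes]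
      rfl
    rw [h, MvPowerSeries.algebraMap_apply, MvPowerSeries.coeff_C, if_neg]
    rintro rfl
    simp at hd
  | add s t hs ht =>
    have h : MvPolynomial.monomial (s + t) r
        = MvPolynomial.monomial s r * MvPolynomial.monomial t (1 : ℝ) := by
      rw [MvPolynomial.monomial_mul, mul_one]
    rw [h, map_mul, MulMemClass.coe_mul, MvPowerSeries.coeff_mul]
    refine Finset.sum_eq_zero fun p hp => ?_
    rw [Finset.HasAntidiagonal.mem_antidiagonal] at hp
    rw [Finsupp.sum_add_index' (by simp) (by intros; ring), ← hp, map_add] at hd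
    by_cases h1 : p.1.degree = s.sum fun i a => a * (i + 1)
    · rw [ht 1 p.2 (fun h2 => hd (by rw [h1, h2])), mul_zero]
    · rw [hs r p.1 h1, zero_mul]
  | single i a =>
    rw [Finsupp.sum_single_index (by simp)] at hd
    induction a generalizing d r with
    | zero =>
      have h : (elemEval (MvPolynomial.monomial (Finsupp.single i 0) r) : MvPowerSeries ℕ ℝ)
          = algebraMap ℝ (MvPowerSeries ℕ ℝ) r := by
        rw [Finsupp.single_zero, ← MvPolynomial.C_apply, ← MvPolynomial.algebraMap_eq,
          AlgHom.commutes]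
        rfl
      rw [h, MvPowerSeries.algebraMap_apply, MvPowerSeries.coeff_C, if_neg]
      rintro rfl
      simp at hd
    | succ a ih =>
      have h : MvPolynomial.monomial (Finsupp.single i (a + 1)) r
          = MvPolynomial.monomial (Finsupp.single i a) r * MvPolynomial.X i := by
        rw [MvPolynomial.X, MvPolynomial.monomial_mul, mul_one, Finsupp.single_add]
      rw [h, map_mul, MulMemClass.coe_mul, MvPowerSeries.coeff_mul]
      refine Finset.sum_eq_zero fun p hp => ?_
      rw [Finset.HasAntidiagonal.mem_antidiagonal] at hp
      rw [← hp, map_add] at hd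
      by_cases h1 : p.1.degree = a * (i + 1)
      · have h2 : MvPowerSeries.coeff p.2 (elemEval (MvPolynomial.X i) : MvPowerSeries ℕ ℝ) = 0 := by
          rw [elemEval, MvPolynomial.aeval_X]
          refine if_neg fun h2 => hd ?_
          rw [h1, h2.1]
          ring
        rw [h2, mul_zero]
      · rw [ih r p.1 h1, zero_mul]

theorem elemEval_surjective : Function.Surjective elemEval := by
  classical
  rintro ⟨f, hf⟩
  obtain ⟨N, hN⟩ := hf.1
  -- the truncation of `f` to `N` variables is a symmetric polynomial
  have hfin : {d : Fin N →₀ ℕ | d.degree ≤ N}.Finite := by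
    refine Set.Finite.subset (Set.finite_Iic (Finsupp.equivFunOnFinite.symm fun _ => N)) ?_
    intro d hd i
    exact (Finsupp.le_degree i d).trans hd
  let F : MvPolynomial (Fin N) ℝ :=
    ∑ d ∈ hfin.toFinset, MvPolynomial.monomial d
      (MvPowerSeries.coeff (d.embDomain Fin.valEmbedding) f)
  have hdeg : ∀ d : Fin N →₀ ℕ, (d.embDomain Fin.valEmbedding).degree = d.degree := fun d => by
    rw [Finsupp.embDomain_eq_mapDomain, Finsupp.degree_mapDomain]
  have hF : ∀ d, MvPolynomial.coeff d F
      = MvPowerSeries.coeff (d.embDomain Fin.valEmbedding) f := by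
    intro d
    simp only [F, MvPolynomial.coeff_sum, MvPolynomial.coeff_monomial, Finset.sum_ite_eq']
    split_ifs with h
    · rfl
    · refine (hN _ ?_).symm
      rw [hdeg]
      simpa using h
  have hsym : F.IsSymmetric := by
    intro σ
    ext d
    obtain ⟨d', rfl⟩ : ∃ d', Finsupp.mapDomain σ d' = d :=
      ⟨Finsupp.mapDomain σ.symm d, by rw [← Finsupp.mapDomain_comp]; simp⟩
    rw [MvPolynomial.coeff_rename_mapDomain _ σ.injective, hF, hF]
    let τ : Equiv.Perm ℕ := σ.viaEmbedding Fin.valEmbedding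
    rw [← coeff_embDomain_of_mem hf τ]
    congr 1
    simp only [Finsupp.embDomain_eq_mapDomain, ← Finsupp.mapDomain_comp]
    refine congrArg (fun g : Fin N → ℕ => MvPowerSeries.coeff (Finsupp.mapDomain g d'))
      (funext fun i => ?_)
    exact σ.viaEmbedding_apply Fin.valEmbedding i
  obtain ⟨P, hP⟩ := (MvPolynomial.esymmAlgHom_fin_bijective ℝ N).2 ⟨F, hsym⟩
  let Q := MvPolynomial.rename (Fin.val : Fin N → ℕ) P
  have hQ := killCompl_elemEval N P
  rw [hP] at hQ
  let wt : (ℕ →₀ ℕ) → ℕ := fun s => s.sum fun i a => a * (i + 1)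
  let Q' : MvPolynomial ℕ ℝ :=
    ∑ s ∈ Q.support with wt s ≤ N, MvPolynomial.monomial s (Q.coeff s)
  refine ⟨Q', Subtype.ext ?_⟩
  have hcoeff : ∀ (A : Finset (ℕ →₀ ℕ)) (d : ℕ →₀ ℕ), MvPowerSeries.coeff d
      (elemEval (∑ s ∈ A, MvPolynomial.monomial s (Q.coeff s)) : MvPowerSeries ℕ ℝ)
      = ∑ s ∈ A, MvPowerSeries.coeff d
        (elemEval (MvPolynomial.monomial s (Q.coeff s)) : MvPowerSeries ℕ ℝ) := by
    intro A d
    rw [map_sum, AddSubmonoidClass.coe_finsetSum, map_sum]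
  have hsmall : ∀ d : ℕ →₀ ℕ, d.degree ≤ N →
      MvPowerSeries.coeff d (elemEval Q' : MvPowerSeries ℕ ℝ)
        = MvPowerSeries.coeff d (elemEval Q : MvPowerSeries ℕ ℝ) := by
    intro d hd
    conv_rhs => rw [Q.as_sum]
    rw [hcoeff, hcoeff, Finset.sum_filter]
    refine Finset.sum_congr rfl fun s _ => ?_
    split_ifs with hs
    · rfl
    · refine (coeff_elemEval_monomial _ _ _ fun h => hs ?_).symm
      change (s.sum fun i a => a * (i + 1)) ≤ N
      rw [← h]
      exact hd
  ext d
  by_cases hd : d.degree ≤ N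
  · -- move the support of `d` into the first `N` variables
    have hcard : d.support.card ≤ N := by
      refine le_trans ?_ hd
      rw [Finsupp.degree_apply d, Finset.card_eq_sum_ones]
      refine Finset.sum_le_sum fun i hi => ?_
      exact Nat.one_le_iff_ne_zero.2 (Finsupp.mem_support_iff.1 hi)
    have he : Fintype.card {x // x ∈ d.support}
        = Fintype.card {x // x ∈ Finset.range d.support.card} := by simp
    let e := Fintype.equivOfCardEq he
    let σ : Equiv.Perm ℕ := e.extendSubtype
    have hmem : ∀ x ∈ d.support, σ x < N := fun x hx =>
      (Finset.mem_range.1 (e.extendSubtype_mem x hx)).trans_le hcard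
    obtain ⟨d', hd'⟩ : ∃ d' : Fin N →₀ ℕ,
        d'.embDomain Fin.valEmbedding = d.embDomain σ.toEmbedding := by
      refine ⟨Finsupp.comapDomain Fin.val (d.embDomain σ.toEmbedding)
        Fin.val_injective.injOn, ?_⟩
      rw [Finsupp.embDomain_eq_mapDomain]
      refine Finsupp.mapDomain_comapDomain _ Fin.val_injective _ fun i hi => ?_
      rw [Finsupp.support_embDomain, Finset.mem_coe, Finset.mem_map] at hi
      obtain ⟨x, hx, rfl⟩ := hi
      exact ⟨⟨σ x, hmem x hx⟩, rfl⟩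
    have hdd : (d.embDomain σ.toEmbedding).degree ≤ N := by
      rw [Finsupp.embDomain_eq_mapDomain, Finsupp.degree_mapDomain]
      exact hd
    rw [← coeff_embDomain_of_mem (elemEval Q').2 σ, ← coeff_embDomain_of_mem hf σ, hsmall _ hdd,
      ← hd', ← hF, ← MvPowerSeries.coeff_killCompl, hQ, MvPolynomial.coeff_coe]
  · rw [hN d (not_le.1 hd), hcoeff]
    refine Finset.sum_eq_zero fun s hs => coeff_elemEval_monomial _ _ _ fun h => hd ?_
    rw [h]
    exact (Finset.mem_filter.1 hs).2

/-- The fundamental theorem of symmetric functions: `Λ = ℝ[e₁, e₂, …]`, a polynomial ring. -/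
noncomputable def elemEquiv : MvPolynomial ℕ ℝ ≃ₐ[ℝ] Lam :=
  AlgEquiv.ofBijective elemEval ⟨elemEval_injective, elemEval_surjective⟩

/-- Partitions correspond to exponent vectors: `λ` goes to `i ↦` the multiplicity of `i + 1`. -/
noncomputable def partExp (μ : Σ n : ℕ, n.Partition) : ℕ →₀ ℕ :=
  Multiset.toFinsupp (μ.2.parts.map fun i => i - 1)

theorem map_pred_succ {s : Multiset ℕ} (hs : ∀ i ∈ s, 0 < i) :
    (s.map fun i => i - 1).map (fun i => i + 1) = s := by
  rw [Multiset.map_map]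
  conv_rhs => rw [← Multiset.map_id s]
  exact Multiset.map_congr rfl fun i hi => Nat.succ_pred_eq_of_pos (hs i hi)

theorem partExp_bijective : Function.Bijective partExp := by
  constructor
  · rintro ⟨n, μ⟩ ⟨m, ν⟩ h
    have h1 := Multiset.toFinsupp.injective h
    have h2 : μ.parts = ν.parts := by
      rw [← map_pred_succ fun i hi => μ.parts_pos hi, ← map_pred_succ fun i hi => ν.parts_pos hi]
      exact congrArg _ h1
    obtain rfl : n = m := by rw [← μ.parts_sum, ← ν.parts_sum, h2]
    rw [Nat.Partition.ext h2]
  · intro s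
    refine ⟨⟨_, ⟨(Finsupp.toMultiset s).map fun i => i + 1, fun {i} hi => ?_, rfl⟩⟩, ?_⟩
    · obtain ⟨j, _, rfl⟩ := Multiset.mem_map.1 hi
      exact Nat.succ_pos j
    · simp [partExp, Multiset.map_map]

/-- The `e`-basis of `Λ`, indexed by all partitions. -/
noncomputable def elemBasis : Module.Basis (Σ n : ℕ, n.Partition) ℝ Lam :=
  ((MvPolynomial.basisMonomials ℕ ℝ).map elemEquiv.toLinearEquiv).reindex
    (Equiv.ofBijective partExp partExp_bijective).symm

/-- The basis vector with index `λ` is `e_λ`. -/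
theorem elemBasis_apply {n : ℕ} (μ : n.Partition) : elemBasis ⟨n, μ⟩ = elemPart μ := by
  have h : ∀ s : Multiset ℕ, elemEval (MvPolynomial.monomial (Multiset.toFinsupp s) 1)
      = (s.map fun i => elem (i + 1)).prod := by
    intro s
    induction s using Multiset.induction_on with
    | empty => simp
    | cons a s ih =>
      rw [← Multiset.singleton_add, map_add, ← mul_one (1 : ℝ), ← MvPolynomial.monomial_mul,
        map_mul, ih, Multiset.toFinsupp_singleton, Multiset.singleton_add, Multiset.map_cons,
        Multiset.prod_cons]
      congr 1
      exact MvPolynomial.aeval_X _ a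
  have h1 : elemBasis ⟨n, μ⟩ = elemEval (MvPolynomial.monomial (partExp ⟨n, μ⟩) 1) := by
    simp [elemBasis, elemEquiv]
    rfl
  rw [h1, partExp, h, elemPart]
  conv_rhs => rw [← map_pred_succ fun i hi => μ.parts_pos hi, Multiset.map_map]
  rfl

/-! ### The `G`-homomorphism and the chromatic symmetric function -/

section Graph

variable {V : Type*} [Fintype V]

open Classical in
/-- `e_k^G`: the sum over all stable `k`-element sets `S` of vertices of `∏_{v ∈ S} v`. -/
noncomputable def gElem (G : SimpleGraph V) (k : ℕ) : MvPolynomial V ℝ :=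
  ∑ S ∈ (Finset.powersetCard k Finset.univ).filter (fun S : Finset V => G.IsIndepSet ↑S),
    ∏ v ∈ S, MvPolynomial.X v

/-- The `G`-homomorphism `φ_G : Λ → ℝ[V]`, the algebra homomorphism with `e_k ↦ e_k^G`. -/
noncomputable def gHom (G : SimpleGraph V) : Lam →ₐ[ℝ] MvPolynomial V ℝ :=
  (MvPolynomial.aeval (R := ℝ) fun i : ℕ => gElem G (i + 1)).comp
    (elemEquiv.symm : Lam →ₐ[ℝ] MvPolynomial ℕ ℝ)

theorem gHom_elem (G : SimpleGraph V) {k : ℕ} (hk : 1 ≤ k) : gHom G (elem k) = gElem G k := by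
  obtain ⟨i, rfl⟩ := Nat.exists_eq_add_of_le' hk
  have h : elemEquiv.symm (elem (i + 1)) = MvPolynomial.X i := by
    rw [AlgEquiv.symm_apply_eq]
    exact (MvPolynomial.aeval_X (R := ℝ) (fun i : ℕ => elem (i + 1)) i).symm
  simp [gHom, h]

/-- The exponent vector of the monomial `x^c = ∏_v x_{c(v)}`. -/
noncomputable def colorExp (c : V → ℕ) : ℕ →₀ ℕ := ∑ v, Finsupp.single (c v) 1

/-- Only finitely many colorings have a given monomial. -/
theorem finite_colorings (G : SimpleGraph V) (d : ℕ →₀ ℕ) :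
    {c : G.Coloring ℕ | colorExp c = d}.Finite := by
  refine Set.Finite.of_injOn (f := fun c : G.Coloring ℕ => (c : V → ℕ))
    (t := {f | ∀ v : V, f v ∈ (d.support : Set ℕ)}) ?_ DFunLike.coe_injective.injOn
    (Set.Finite.pi' fun _ => d.support.finite_toSet)
  rintro c rfl v
  change c v ∈ _
  rw [Finset.mem_coe, Finsupp.mem_support_iff, colorExp, Finsupp.finsetSum_apply]
  refine (Finset.sum_pos' (fun _ _ => Nat.zero_le _) ⟨v, Finset.mem_univ v, ?_⟩).ne'
  simp

/-- The chromatic symmetric function `X_G = ∑_c x^c`, the sum over all proper colorings `c` of `G`: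
the coefficient of a monomial is the number of proper colorings `c` with this monomial. -/
noncomputable def chromatic (G : SimpleGraph V) : Lam :=
  ⟨fun d => ({c : G.Coloring ℕ | colorExp c = d}.ncard : ℝ), by
    have hdeg : ∀ c : V → ℕ, (colorExp c).degree = Fintype.card V := by
      intro c
      rw [colorExp, map_sum]
      simp
    refine ⟨⟨Fintype.card V, fun d hd => ?_⟩, rename_eq_self fun σ d => ?_⟩
    · have h : {c : G.Coloring ℕ | colorExp c = d} = ∅ := by
        refine Set.eq_empty_iff_forall_notMem.2 fun c hc => ?_
        have h1 := hdeg c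
        rw [show colorExp c = d from hc] at h1
        omega
      change ((Set.ncard {c : G.Coloring ℕ | colorExp c = d} : ℕ) : ℝ) = 0
      rw [h, Set.ncard_empty, Nat.cast_zero]
    · change ((Set.ncard {c : G.Coloring ℕ | colorExp c = d.embDomain σ.toEmbedding} : ℕ) : ℝ)
        = ((Set.ncard {c : G.Coloring ℕ | colorExp c = d} : ℕ) : ℝ)
      have hcomp : ∀ (τ : Equiv.Perm ℕ) (c : V → ℕ),
          colorExp (τ ∘ c) = Finsupp.mapDomain τ (colorExp c) := by
        intro τ c
        rw [colorExp, colorExp, Finsupp.mapDomain_finsetSum]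
        simp [Finsupp.mapDomain_single]
      let rec1 : Equiv.Perm ℕ → G.Coloring ℕ → G.Coloring ℕ := fun τ c =>
        SimpleGraph.Coloring.mk (τ ∘ c) fun {_ _} h h' => c.valid h (τ.injective h')
      have hrec : ∀ (τ : Equiv.Perm ℕ) (c : G.Coloring ℕ),
          colorExp (rec1 τ c) = Finsupp.mapDomain τ (colorExp c) := fun τ c => hcomp τ c
      rw [Finsupp.embDomain_eq_mapDomain]
      congr 1
      symm
      refine Set.ncard_congr (fun c _ => rec1 σ c) ?_ ?_ ?_
      · rintro c rfl
        exact hrec σ c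
      · intro c c' _ _ h
        refine DFunLike.ext _ _ fun v => σ.injective ?_
        exact DFunLike.congr_fun h v
      · intro c hc
        refine ⟨rec1 σ.symm c, ?_, ?_⟩
        · change colorExp _ = _
          rw [hrec, show colorExp c = _ from hc, ← Finsupp.mapDomain_comp]
          simp
        · refine DFunLike.ext _ _ fun v => ?_
          exact σ.apply_symm_apply (c v)⟩

/-- `c_λ(G)`, the coefficient of `e_λ` in the expansion of `X_G` in the `e`-basis. -/
noncomputable def eCoeff (G : SimpleGraph V) {n : ℕ} (μ : n.Partition) : ℝ :=
  elemBasis.repr (chromatic G) ⟨n, μ⟩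

end Graph

/-- The partition `(l, 1)` of `l + 1`, for `l ≥ 1`. -/
def hookPart (l : ℕ) (hl : 1 ≤ l) : (l + 1).Partition where
  parts := {l, 1}
  parts_pos := by
    intro i hi
    rw [Multiset.insert_eq_cons, Multiset.mem_cons, Multiset.mem_singleton] at hi
    omega
  parts_sum := by simp

/-- A polynomial lies in `ℕ[V]`: all its coefficients are non-negative integers. -/
def MonomialPositive {V : Type*} (f : MvPolynomial V ℝ) : Prop :=
  ∀ α : V →₀ ℕ, ∃ k : ℕ, MvPolynomial.coeff α f = k

/-! ### Unit interval orders and correct sequences -/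

section Order

variable {U : Type*} [PartialOrder U]

/-- A unit interval order: (isomorphic to) a subset of `ℝ` with `u ≻ w` iff `u ≥ w + 1`. -/
def IsUnitIntervalOrder (U : Type*) [PartialOrder U] : Prop :=
  ∃ f : U → ℝ, Function.Injective f ∧ ∀ u w : U, u > w ↔ f u ≥ f w + 1

/-- The incomparability graph. -/
def incGraph (U : Type*) [PartialOrder U] : SimpleGraph U where
  Adj u w := ¬ u ≤ w ∧ ¬ w ≤ u
  symm := ⟨fun _ _ h => ⟨h.2, h.1⟩⟩
  loopless := ⟨fun _ h => h.1 le_rfl⟩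

/-- Correct sequences `(w_1, …, w_k)`: never `w_i ≻ w_{i+1}`, and for each `j ≥ 2` there is `i < j`
with `w_i ⊀ w_j`. -/
def IsCorrect {k : ℕ} (w : Fin k → U) : Prop :=
  (∀ i j : Fin k, (j : ℕ) = i + 1 → ¬ w i > w j) ∧
    ∀ j : Fin k, 0 < (j : ℕ) → ∃ i : Fin k, i < j ∧ ¬ w i < w j

open Classical in
/-- `M_{l,1}^U`: the pairs of a correct sequence `w` of length `l` and an element `z` such that
`z ≻ w_i` for all `i`, or `z ≺ w_l`. -/
noncomputable def pairs (U : Type*) [Fintype U] [PartialOrder U] (l : ℕ) :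
    Finset ((Fin l → U) × U) :=
  Finset.univ.filter fun p => IsCorrect p.1 ∧
    ((∀ i : Fin l, p.2 > p.1 i) ∨ ∃ i : Fin l, (i : ℕ) + 1 = l ∧ p.2 < p.1 i)

end Order

end ChromaticSymm

/-! Write `φ` for the homomorphism `f ↦ f^U` and `p_k` for the power sums. The core is
`gHom_powerSum`: for `k ≥ 1`, `φ(p_k)` is the sum of the monomials of all correct sequences of
length `k`. Newton's identities determine the `p_k` recursively from the `e_i`, so it suffices that
the sums over correct sequences satisfy the same identities (`newton_correctSum`). This is a
cancellation: a product of `e_i^U` with a sum over correct sequences runs over pairs of a chain and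
a sequence, and moving one element between the chain and the end of the sequence matches terms of
opposite sign (`sum_not_separated`). What survives is chains with one marked element, that is `k
e_k^U`.

For `l ≥ 2` one has `m_{l,1} = p_l p_1 - p_{l+1}`. A correct sequence of length `l + 1` is a correct
`w` of length `l` followed by a suitable `z`, so the difference runs over the pairs `(w, z)` for
which appending `z` destroys correctness. These are exactly the pairs in `M_{l,1}`. Positivity is
then visible; for `l = 1` the function is `e_2`.

For the `e`-coefficients, a coloring is a tuple of disjoint stable sets covering `V`, so the
coefficient of `m_μ` in `X_G` is that of `∏ v` in `φ_G(e_μ)`. The transition matrix from the `e_μ`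
to the `m_ν` is symmetric, so `e` and `m` may be exchanged: the coefficient of `e_μ` in `X_G` is
that of `∏ v` in `φ_G(m_μ)`, which positivity bounds below by zero. -/

namespace ChromaticSymm

/-! ### Newton's identities in `Λ` -/

/-- The power sum symmetric function `p_k` (for `k ≥ 1`). -/
noncomputable def powerSum (k : ℕ) : Lam := mono (Nat.Partition.indiscrete k)

/-- Two symmetric functions agree if they agree in every finite number of variables. -/
theorem lam_ext {f g : Lam}
    (h : ∀ m, MvPowerSeries.killCompl (Fin.valEmbedding (n := m)) (f : MvPowerSeries ℕ ℝ)
      = MvPowerSeries.killCompl (Fin.valEmbedding (n := m)) (g : MvPowerSeries ℕ ℝ)) : f = g := by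
  refine Subtype.ext ?_
  ext d
  obtain ⟨m, hm⟩ : ∃ m : ℕ, ∀ i ∈ d.support, i < m :=
    ⟨d.support.sup id + 1, fun i hi => Nat.lt_succ_of_le (Finset.le_sup (f := id) hi)⟩
  obtain ⟨d', rfl⟩ : d ∈ Set.range (Finsupp.embDomain (Fin.valEmbedding (n := m))) := by
    rw [Finsupp.mem_range_embDomain_iff]
    exact fun i hi => ⟨⟨i, hm i hi⟩, rfl⟩
  rw [← MvPowerSeries.coeff_killCompl, ← MvPowerSeries.coeff_killCompl, h m]

theorem coeff_mono {n : ℕ} (μ : n.Partition) (d : ℕ →₀ ℕ) [Decidable (d.support.val.map d = μ.parts)] :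
    MvPowerSeries.coeff d (mono μ : MvPowerSeries ℕ ℝ)
      = if d.support.val.map d = μ.parts then 1 else 0 := by
  split_ifs with h
  · exact if_pos h
  · exact if_neg h

theorem coeff_elem (k : ℕ) (d : ℕ →₀ ℕ) [Decidable (d.degree = k ∧ ∀ i, d i ≤ 1)] :
    MvPowerSeries.coeff d (elem k : MvPowerSeries ℕ ℝ)
      = if d.degree = k ∧ ∀ i, d i ≤ 1 then 1 else 0 := by
  split_ifs with h
  · exact if_pos h
  · exact if_neg h

theorem coeff_killCompl_mono (m : ℕ) {n : ℕ} (μ : n.Partition) (d : Fin m →₀ ℕ)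
    [Decidable (d.support.val.map d = μ.parts)] :
    MvPowerSeries.coeff d (MvPowerSeries.killCompl (Fin.valEmbedding (n := m))
      (mono μ : MvPowerSeries ℕ ℝ)) = if d.support.val.map d = μ.parts then 1 else 0 := by
  classical
  rw [MvPowerSeries.coeff_killCompl, coeff_mono]
  refine if_congr ?_ rfl rfl
  rw [Finsupp.support_embDomain, Finset.map_val, Multiset.map_map]
  have h : d.embDomain Fin.valEmbedding ∘ Fin.valEmbedding = d :=
    funext fun i => Finsupp.embDomain_apply_self _ _ _
  rw [h]

theorem map_support_eq_singleton {σ : Type*} (d : σ →₀ ℕ) {k : ℕ} (hk : k ≠ 0) :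
    d.support.val.map d = {k} ↔ ∃ i, d = Finsupp.single i k := by
  classical
  constructor
  · intro h
    obtain ⟨i, hi, hk⟩ := Multiset.map_eq_singleton.1 h
    refine ⟨i, ?_⟩
    rw [← hk]
    ext j
    rw [Finsupp.single_apply]
    split_ifs with hj
    · rw [hj]
    · rw [← Finsupp.notMem_support_iff, ← Finset.mem_val, hi, Multiset.mem_singleton]
      exact fun h => hj h.symm
  · rintro ⟨i, rfl⟩
    rw [Finsupp.support_single _ hk]
    simp

theorem killCompl_powerSum (m : ℕ) {k : ℕ} (hk : k ≠ 0) :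
    MvPowerSeries.killCompl (Fin.valEmbedding (n := m)) (powerSum k : MvPowerSeries ℕ ℝ)
      = (MvPolynomial.psum (Fin m) ℝ k : MvPowerSeries (Fin m) ℝ) := by
  classical
  ext d
  rw [powerSum, coeff_killCompl_mono, Nat.Partition.indiscrete_parts hk, MvPolynomial.coeff_coe,
    MvPolynomial.psum, MvPolynomial.coeff_sum]
  simp only [MvPolynomial.coeff_X_pow, map_support_eq_singleton d hk]
  split_ifs with h
  · obtain ⟨i, rfl⟩ := h
    rw [Finset.sum_eq_single i]
    · simp
    · intro j _ hj
      exact if_neg fun h => hj ((Finsupp.single_left_injective hk) h)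
    · simp
  · refine (Finset.sum_eq_zero fun i _ => if_neg fun h' => h ⟨i, h'.symm⟩).symm

theorem sum_antidiagonal_lt {M : Type*} [AddCommMonoid M] (k : ℕ) (f : ℕ → ℕ → M) :
    ∑ a ∈ Finset.HasAntidiagonal.antidiagonal (k + 1) with a.1 < k + 1, f a.1 a.2
      = ∑ i ∈ Finset.range (k + 1), f i (k - i + 1) := by
  rw [Finset.sum_filter, Finset.Nat.sum_antidiagonal_eq_sum_range_succ_mk, Finset.sum_range_succ]
  simp only [lt_irrefl, if_false, add_zero]
  refine Finset.sum_congr rfl fun i hi => ?_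
  have hi := Finset.mem_range.1 hi
  rw [if_pos hi, Nat.succ_sub (by omega)]

/-- `lam_ext` reduces this to Newton's identities for polynomials in `m` variables. -/
theorem newton (k : ℕ) :
    ((k + 1 : ℕ) : Lam) * elem (k + 1) = (-1) ^ k *
      ∑ i ∈ Finset.range (k + 1), (-1) ^ i * (elem i * powerSum (k - i + 1)) := by
  refine lam_ext fun m => ?_
  have h := congrArg (MvPolynomial.coeToMvPowerSeries.ringHom (R := ℝ))
    (MvPolynomial.mul_esymm_eq_sum (Fin m) ℝ (k + 1))
  rw [sum_antidiagonal_lt k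
    (fun i j => (-1) ^ i * MvPolynomial.esymm (Fin m) ℝ i * MvPolynomial.psum (Fin m) ℝ j)] at h
  have h1 : ∀ f : Lam, (f : MvPowerSeries ℕ ℝ) = Lam.val f := fun f => rfl
  simp only [map_mul, map_pow, map_neg, map_one, map_sum, map_natCast,
    MvPolynomial.coeToMvPowerSeries.ringHom_apply, ← killCompl_elem,
    ← killCompl_powerSum m (Nat.succ_ne_zero _)] at h
  simp only [h1, map_mul, map_pow, map_neg, map_one, map_sum, map_natCast] at h ⊢
  -- At index `k + 1` the polynomial identity carries the sign `(-1) ^ (k + 2)`.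
  rw [h, pow_add (-1) k 2]
  simp [mul_assoc]

/-! ### The monomial symmetric functions `m_{l,1}` -/

theorem map_support_eq_pair {σ : Type*} [DecidableEq σ] (d : σ →₀ ℕ) {k : ℕ} (hk : 2 ≤ k) :
    d.support.val.map d = {k, 1} ↔
      ∃ i j, i ≠ j ∧ d = Finsupp.single i k + Finsupp.single j 1 := by
  constructor
  · intro h
    obtain ⟨i, hi, hik, h1⟩ := (Multiset.map_eq_cons _ _ _ _).2 h
    obtain ⟨j, hj, hjk⟩ := Multiset.map_eq_singleton.1 h1
    have hij : i ≠ j := by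
      rintro rfl
      omega
    have hs : d.support.val = {i, j} := by
      rw [← Multiset.cons_erase hi, hj]
      rfl
    refine ⟨i, j, hij, ?_⟩
    ext a
    rw [Finsupp.add_apply, Finsupp.single_apply, Finsupp.single_apply]
    by_cases h1 : i = a
    · subst h1
      simp [hij.symm, hik]
    · by_cases h2 : j = a
      · subst h2
        simp [hij, hjk]
      · rw [if_neg h1, if_neg h2, add_zero, ← Finsupp.notMem_support_iff, ← Finset.mem_val, hs]
        simp [Ne.symm h1, Ne.symm h2]
  · rintro ⟨i, j, hij, rfl⟩
    rw [Finsupp.support_add_eq, Finsupp.support_single _ (by omega), Finsupp.support_single _ one_ne_zero,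
      ← Finset.insert_eq, Finset.insert_val_of_notMem (by simpa using hij)]
    · simp [Finsupp.single_apply, hij]
    · rw [Finsupp.support_single _ (by omega), Finsupp.support_single _ one_ne_zero]
      simpa using hij

/-- Multiply out `∑ x_i^l · ∑ x_j`: the diagonal gives `p_{l+1}`. Since `l ≥ 2`, the monomial `x_i^l
x_j` with `i ≠ j` determines the ordered pair `(i, j)`, so each off-diagonal monomial occurs once.
-/
theorem powerSum_mul_powerSum_one {l : ℕ} (hl : 2 ≤ l) :
    powerSum l * powerSum 1 = powerSum (l + 1) + mono (hookPart l (one_le_two.trans hl)) := by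
  classical
  refine lam_ext fun m => ?_
  rw [MulMemClass.coe_mul, AddMemClass.coe_add, map_mul, map_add, killCompl_powerSum m (by omega),
    killCompl_powerSum m one_ne_zero, killCompl_powerSum m (by omega), ← MvPolynomial.coe_mul]
  have h : MvPolynomial.psum (Fin m) ℝ l * MvPolynomial.psum (Fin m) ℝ 1
      = MvPolynomial.psum (Fin m) ℝ (l + 1)
        + ∑ p : Fin m × Fin m with p.1 ≠ p.2, MvPolynomial.monomial
          (Finsupp.single p.1 l + Finsupp.single p.2 1) 1 := by
    simp only [MvPolynomial.psum, MvPolynomial.X_pow_eq_monomial]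
    rw [Finset.sum_mul_sum, ← Finset.sum_product', Finset.univ_product_univ,
      ← Finset.sum_filter_add_sum_filter_not _ (fun p : Fin m × Fin m => p.1 = p.2)]
    congr 1
    · refine Finset.sum_nbij' Prod.fst (fun i => (i, i)) ?_ ?_ ?_ ?_ ?_
      · simp
      · simp
      · rintro ⟨a, b⟩ h
        simpa using h
      · simp
      · rintro ⟨a, b⟩ h
        obtain rfl : a = b := by simpa using h
        rw [MvPolynomial.monomial_mul, ← Finsupp.single_add, one_mul]
    · refine Finset.sum_congr rfl fun p _ => ?_
      rw [MvPolynomial.monomial_mul, one_mul]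
  rw [h, MvPolynomial.coe_add]
  congr 1
  ext d
  rw [coeff_killCompl_mono, MvPolynomial.coeff_coe, MvPolynomial.coeff_sum]
  change _ = if d.support.val.map d = {l, 1} then (1 : ℝ) else 0
  simp only [MvPolynomial.coeff_monomial, map_support_eq_pair d hl]
  split_ifs with h
  · obtain ⟨i, j, hij, rfl⟩ := h
    rw [Finset.sum_eq_single (i, j), if_pos rfl]
    · rintro ⟨a, b⟩ hab hne
      refine if_neg fun h => hne ?_
      have hab : a ≠ b := by simpa using hab
      have h1 := DFunLike.congr_fun h i
      have h2 := DFunLike.congr_fun h j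
      simp only [Finsupp.add_apply, Finsupp.single_apply, if_pos, if_neg hij, if_neg hij.symm] at h1 h2
      grind
    · intro h
      simp [hij] at h
  · refine Finset.sum_eq_zero fun p hp => if_neg fun h' => h ⟨p.1, p.2, ?_, h'.symm⟩
    simpa using hp

theorem mono_hookPart_one : mono (hookPart 1 le_rfl) = elem 2 := by
  classical
  refine Subtype.ext ?_
  ext d
  rw [coeff_mono, coeff_elem]
  refine if_congr ?_ rfl rfl
  change d.support.val.map d = Multiset.replicate 2 1 ↔ _
  rw [Multiset.eq_replicate, Multiset.card_map]
  have h1 : (∀ b ∈ d.support.val.map d, b = 1) ↔ ∀ i, d i ≤ 1 := by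
    simp only [Multiset.mem_map, Finset.mem_val, Finsupp.mem_support_iff]
    constructor
    · intro h i
      by_cases h0 : d i = 0
      · omega
      · exact (h _ ⟨i, h0, rfl⟩).le
    · rintro h _ ⟨i, hi, rfl⟩
      have := h i
      omega
  rw [h1]
  refine and_congr_left fun h => ?_
  have h2 : d.degree = d.support.val.card := by
    rw [Finsupp.degree_apply, Finset.card_val, Finset.card_eq_sum_ones]
    refine Finset.sum_congr rfl fun i hi => ?_
    have := h i
    have := Finsupp.mem_support_iff.1 hi
    omega
  rw [h2]

/-! ### Newton's identities for correct sequences -/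

section Correct

variable {U : Type*} [PartialOrder U]

/-- Appending a letter adds conditions at the new last position only. This recursion drives both the
exchange with chains and the description of `M_{l,1}`. -/
theorem isCorrect_snoc {j : ℕ} (w : Fin (j + 1) → U) (x : U) :
    IsCorrect (Fin.snoc w x : Fin (j + 2) → U) ↔
      IsCorrect w ∧ ¬ x < w (Fin.last j) ∧ ∃ i, ¬ w i < x := by
  constructor
  · rintro ⟨h1, h2⟩
    refine ⟨⟨fun a b hab => ?_, fun b hb => ?_⟩, ?_, ?_⟩
    · simpa using h1 a.castSucc b.castSucc (by simpa using hab)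
    · obtain ⟨i, hi, h⟩ := h2 b.castSucc (by simpa using hb)
      have hi' : (i : ℕ) < b := hi
      obtain ⟨i, rfl⟩ : ∃ i', Fin.castSucc i' = i := ⟨⟨i, by omega⟩, rfl⟩
      exact ⟨i, hi', by simpa using h⟩
    · simpa using h1 (Fin.last j).castSucc (Fin.last (j + 1)) (by simp)
    · obtain ⟨i, hi, h⟩ := h2 (Fin.last (j + 1)) (by simp)
      obtain ⟨i, rfl⟩ := Fin.eq_castSucc_of_ne_last hi.ne
      exact ⟨i, by simpa using h⟩
  · rintro ⟨⟨h1, h2⟩, h3, i, h4⟩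
    refine ⟨fun a b => ?_, fun b => ?_⟩
    · refine Fin.lastCases ?_ (fun b => ?_) b
      · intro hab
        obtain rfl : a = (Fin.last j).castSucc := Fin.ext (by simpa using hab.symm)
        simpa using h3
      · intro hab
        obtain ⟨a, rfl⟩ : ∃ a', Fin.castSucc a' = a :=
          ⟨⟨a, by have := b.2; rw [Fin.val_castSucc] at hab; omega⟩, rfl⟩
        simpa using h1 a b (by simpa using hab)
    · refine Fin.lastCases ?_ (fun b => ?_) b
      · intro _
        exact ⟨i.castSucc, Fin.castSucc_lt_last i, by simpa using h4⟩
      · intro hb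
        obtain ⟨i, hi, h⟩ := h2 b (by simpa using hb)
        exact ⟨i.castSucc, Fin.castSucc_lt_castSucc_iff.2 hi, by simpa using h⟩

theorem isCorrect_one (w : Fin 1 → U) : IsCorrect w :=
  ⟨fun i j h => by omega, fun j h => by omega⟩

theorem isIndepSet_incGraph (S : Set U) :
    (incGraph U).IsIndepSet S ↔ ∀ u ∈ S, ∀ v ∈ S, u ≤ v ∨ v ≤ u := by
  constructor
  · intro h u hu v hv
    by_cases huv : u = v
    · exact Or.inl huv.le
    · have := h hu hv huv
      change ¬ (¬ u ≤ v ∧ ¬ v ≤ u) at this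
      tauto
  · intro h u hu v hv _ huv
    have := h u hu v hv
    change ¬ u ≤ v ∧ ¬ v ≤ u at huv
    tauto

/-! ### Exchanging elements between chains and correct sequences -/

/-- Every element of `S` is above all entries of `w` or below the last one. -/
def Separated {j : ℕ} (w : Fin (j + 1) → U) (S : Finset U) : Prop :=
  ∀ s ∈ S, (∀ i, w i < s) ∨ s < w (Fin.last j)

/-- In this form `x` is strictly comparable to every element of `S`; hence `x ∉ S`, and `x` can be
added to the chain `S`. -/
theorem separated_snoc {j : ℕ} (w : Fin (j + 1) → U) (x : U) (S : Finset U) :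
    Separated (Fin.snoc w x : Fin (j + 2) → U) S ↔
      ∀ s ∈ S, ((∀ i, w i < s) ∧ x < s) ∨ s < x := by
  simp only [Separated, Fin.forall_fin_succ', Fin.snoc_castSucc, Fin.snoc_last]

variable [Fintype U]

open Classical in
/-- The sum of the monomials of all correct sequences of length `k`. -/
noncomputable def correctSum (U : Type*) [Fintype U] [PartialOrder U] (k : ℕ) :
    MvPolynomial U ℝ :=
  ∑ w : Fin k → U with IsCorrect w, ∏ i, MvPolynomial.X (w i)

open Classical in
/-- The stable sets of the incomparability graph with `i` elements, i.e. the `i`-element chains. -/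
noncomputable def chains (U : Type*) [Fintype U] [PartialOrder U] (i : ℕ) : Finset (Finset U) :=
  (Finset.powersetCard i Finset.univ).filter fun S : Finset U => (incGraph U).IsIndepSet ↑S

theorem mem_chains {i : ℕ} {S : Finset U} :
    S ∈ chains U i ↔ S.card = i ∧ ∀ u ∈ S, ∀ v ∈ S, u ≤ v ∨ v ≤ u := by
  classical
  rw [chains, Finset.mem_filter, Finset.mem_powersetCard, isIndepSet_incGraph]
  simp

open Classical in
/-- The pairs of a correct sequence of length `j` and a chain of size `i`. -/
noncomputable def correctChainPairs (U : Type*) [Fintype U] [PartialOrder U] (i j : ℕ) :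
    Finset ((Fin j → U) × Finset U) :=
  (Finset.univ.filter IsCorrect) ×ˢ chains U i

theorem mem_correctChainPairs {i j : ℕ} {p : (Fin j → U) × Finset U} :
    p ∈ correctChainPairs U i j ↔ IsCorrect p.1 ∧ p.2 ∈ chains U i := by
  simp [correctChainPairs]

/-- The monomial of a sequence and a set. -/
noncomputable def pairWeight {j : ℕ} (p : (Fin j → U) × Finset U) : MvPolynomial U ℝ :=
  (∏ i, MvPolynomial.X (p.1 i)) * ∏ v ∈ p.2, MvPolynomial.X v

theorem gElem_mul_correctSum (i j : ℕ) :
    gElem (incGraph U) i * correctSum U j = ∑ p ∈ correctChainPairs U i j, pairWeight p := by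
  classical
  rw [correctChainPairs, Finset.sum_product, correctSum, gElem, mul_comm, Finset.sum_mul_sum]
  refine Finset.sum_congr (by congr) fun w _ => ?_
  exact Finset.sum_congr (by rw [chains]) fun S _ => rfl

open Classical in
/-- Moving the largest element of a chain that is not above all entries of a sequence to the end of
this sequence. -/
theorem sum_not_separated (i j : ℕ) :
    ∑ p ∈ correctChainPairs U i (j + 2) with Separated p.1 p.2, pairWeight p
      = ∑ p ∈ correctChainPairs U (i + 1) (j + 1) with ¬ Separated p.1 p.2, pairWeight p := by
  refine Finset.sum_nbij
    (fun p => ((Fin.init p.1 : Fin (j + 1) → U), insert (p.1 (Fin.last (j + 1))) p.2)) ?_ ?_ ?_ ?_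
  · rintro ⟨w', S⟩ h
    obtain ⟨w, x, rfl⟩ : ∃ (w : Fin (j + 1) → U) (x : U), w' = Fin.snoc w x :=
      ⟨_, _, (Fin.snoc_init_self w').symm⟩
    rw [Finset.mem_filter, mem_correctChainPairs, mem_chains, separated_snoc, isCorrect_snoc] at h
    obtain ⟨⟨⟨hw, hx, a, ha⟩, hc, hS⟩, hsep⟩ := h
    have hxS : x ∉ S := fun hx => by
      have := hsep x hx
      simp at this
    simp only [Fin.init_snoc, Fin.snoc_last]
    rw [Finset.mem_filter, mem_correctChainPairs, mem_chains]
    refine ⟨⟨hw, ?_, ?_⟩, fun h => ?_⟩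
    -- The inserted `x` itself witnesses that the new pair is not separated: by correctness it is
    -- neither above all entries of `w` nor below the last one.
    · simp [hxS, hc]
    · intro u hu v hv
      rw [Finset.mem_insert] at hu hv
      have h1 : ∀ s ∈ S, s ≤ x ∨ x ≤ s := fun s hs => (hsep s hs).elim
        (fun h => Or.inr h.2.le) (fun h => Or.inl h.le)
      rcases hu with rfl | hu <;> rcases hv with rfl | hv
      · exact Or.inl le_rfl
      · exact (h1 v hv).symm
      · exact h1 u hu
      · exact hS u hu v hv
    · rcases h x (Finset.mem_insert_self _ _) with h | h
      · exact ha (h a)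
      · exact hx h
  · rintro ⟨w₁, S₁⟩ h₁ ⟨w₂, S₂⟩ h₂ h
    obtain ⟨w, x, rfl⟩ : ∃ (w : Fin (j + 1) → U) (x : U), w₁ = Fin.snoc w x :=
      ⟨_, _, (Fin.snoc_init_self w₁).symm⟩
    obtain ⟨w', x', rfl⟩ : ∃ (w : Fin (j + 1) → U) (x : U), w₂ = Fin.snoc w x :=
      ⟨_, _, (Fin.snoc_init_self w₂).symm⟩
    rw [Finset.mem_coe, Finset.mem_filter, mem_correctChainPairs, mem_chains, separated_snoc,
      isCorrect_snoc] at h₁ h₂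
    obtain ⟨⟨⟨-, -, a, ha⟩, -, -⟩, hsep⟩ := h₁
    obtain ⟨⟨⟨-, -, a', ha'⟩, -, -⟩, hsep'⟩ := h₂
    simp only [Fin.init_snoc, Fin.snoc_last, Prod.mk.injEq] at h
    obtain ⟨rfl, h⟩ := h
    have hxS : x ∉ S₁ := fun hx => by
      have := hsep x hx
      simp at this
    have hxS' : x' ∉ S₂ := fun hx => by
      have := hsep' x' hx
      simp at this
    -- If `x ≠ x'`, each lies in the other's chain. Neither is above all entries of `w`, so
    -- separation forces both `x < x'` and `x' < x`.
    have hxx : x = x' := by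
      by_contra hne
      have h1 : x ∈ insert x' S₂ := h ▸ Finset.mem_insert_self _ _
      have h2 : x' ∈ insert x S₁ := h ▸ Finset.mem_insert_self _ _
      rw [Finset.mem_insert, or_iff_right hne] at h1
      rw [Finset.mem_insert, or_iff_right (Ne.symm hne)] at h2
      have h3 : x < x' := (hsep' x h1).resolve_left fun h => ha (h.1 a)
      have h4 : x' < x := (hsep x' h2).resolve_left fun h => ha' (h.1 a')
      exact lt_asymm h3 h4
    subst hxx
    rw [← Finset.erase_insert hxS, h, Finset.erase_insert hxS']
  · rintro ⟨w, T⟩ h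
    rw [Finset.mem_coe, Finset.mem_filter, mem_correctChainPairs, mem_chains] at h
    obtain ⟨⟨hw, hc, hT⟩, hsep⟩ := h
    simp only [Separated, not_forall, not_or] at hsep
    obtain ⟨s₀, hs₀, ⟨a, ha⟩, hs₀'⟩ := hsep
    -- The element to move is the largest one in the chain not above all entries of `w`. It
    -- dominates the violating `s₀`, so it is not below the last entry either and may be appended.
    obtain ⟨x, hxs, hx⟩ := (T.filter fun s => ∃ i, ¬ w i < s).exists_le_maximal
      (Finset.mem_filter.2 ⟨hs₀, a, ha⟩)
    have hxT := (Finset.mem_filter.1 hx.prop).1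
    obtain ⟨b, hb⟩ := (Finset.mem_filter.1 hx.prop).2
    refine ⟨(Fin.snoc w x, T.erase x), ?_, ?_⟩
    · rw [Finset.mem_coe, Finset.mem_filter, mem_correctChainPairs, mem_chains, separated_snoc,
        isCorrect_snoc]
      refine ⟨⟨⟨hw, fun h => hs₀' (hxs.trans_lt h), b, hb⟩, ?_, ?_⟩, ?_⟩
      · rw [Finset.card_erase_of_mem hxT, hc, Nat.add_sub_cancel]
      · exact fun u hu v hv => hT u (Finset.mem_of_mem_erase hu) v (Finset.mem_of_mem_erase hv)
      · intro s hs
        obtain ⟨hsx, hsT⟩ := Finset.mem_erase.1 hs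
        -- An `s` above all entries cannot be `≤ x`, as `x` is not above `w b`; any other `s` is
        -- below `x` by maximality.
        by_cases hsw : ∀ i, w i < s
        · refine Or.inl ⟨hsw, ?_⟩
          rcases hT s hsT x hxT with h | h
          · exact absurd ((hsw b).trans_le h) hb
          · exact lt_of_le_of_ne h (Ne.symm hsx)
        · right
          rcases hT s hsT x hxT with h | h
          · exact lt_of_le_of_ne h hsx
          · refine absurd (hx.eq_of_le ?_ h) (Ne.symm hsx)
            exact Finset.mem_filter.2 ⟨hsT, not_forall.1 hsw⟩
    · simp [Finset.insert_erase hxT]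
  · rintro ⟨w', S⟩ h
    obtain ⟨w, x, rfl⟩ : ∃ (w : Fin (j + 1) → U) (x : U), w' = Fin.snoc w x :=
      ⟨_, _, (Fin.snoc_init_self w').symm⟩
    rw [Finset.mem_filter, mem_correctChainPairs, mem_chains, separated_snoc] at h
    have hxS : x ∉ S := fun hx => by
      have := h.2 x hx
      simp at this
    simp [pairWeight, Fin.prod_univ_castSucc, hxS, mul_assoc]

theorem sum_not_separated_zero (j : ℕ) [DecidablePred fun p : (Fin (j + 1) → U) × Finset U =>
      ¬ Separated p.1 p.2] :
    ∑ p ∈ correctChainPairs U 0 (j + 1) with ¬ Separated p.1 p.2, pairWeight p = 0 := by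
  refine Finset.sum_eq_zero ?_
  rintro ⟨w, S⟩ h
  rw [Finset.mem_filter, mem_correctChainPairs, mem_chains] at h
  obtain rfl := Finset.card_eq_zero.1 h.1.2.1
  exact absurd (fun s hs => absurd hs (Finset.notMem_empty s)) h.2

-- For a sequence with the single entry `x`, being separated means that `x` is strictly comparable
-- to every element of the chain. Such a pair is a chain of size `i + 1` with a marked element `x`,
-- hence the factor `i + 1`.
open Classical in
theorem sum_separated_one (i : ℕ) :
    ∑ p ∈ correctChainPairs U i 1 with Separated p.1 p.2, pairWeight p
      = ((i + 1 : ℕ) : MvPolynomial U ℝ) * gElem (incGraph U) (i + 1) := by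
  have h1 : ((i + 1 : ℕ) : MvPolynomial U ℝ) * gElem (incGraph U) (i + 1)
      = ∑ q ∈ (chains U (i + 1)).sigma (fun T => T), ∏ v ∈ q.1, MvPolynomial.X v := by
    rw [Finset.sum_sigma, gElem, Finset.mul_sum]
    refine Finset.sum_congr (by rw [chains]) fun T hT => ?_
    simp only [Finset.sum_const, (mem_chains.1 hT).1, nsmul_eq_mul]
  have hmem : ∀ p : (Fin 1 → U) × Finset U,
      p ∈ (correctChainPairs U i 1).filter (fun p => Separated p.1 p.2) ↔
        (p.2.card = i ∧ ∀ u ∈ p.2, ∀ v ∈ p.2, u ≤ v ∨ v ≤ u) ∧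
          ∀ s ∈ p.2, p.1 0 < s ∨ s < p.1 0 := by
    intro p
    rw [Finset.mem_filter, mem_correctChainPairs, mem_chains]
    simp [isCorrect_one, Separated]
  rw [h1]
  refine Finset.sum_nbij' (fun p => ⟨insert (p.1 0) p.2, p.1 0⟩)
    (fun q => (fun _ => q.2, q.1.erase q.2)) ?_ ?_ ?_ ?_ ?_
  all_goals simp only [hmem, Finset.mem_sigma, mem_chains, Prod.forall, Sigma.forall]
  · rintro w S ⟨⟨hc, hS⟩, hsep⟩
    have hx : w 0 ∉ S := fun h => by simpa using hsep _ h
    refine ⟨⟨by simp [hx, hc], ?_⟩, Finset.mem_insert_self _ _⟩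
    have h1 : ∀ s ∈ S, s ≤ w 0 ∨ w 0 ≤ s := fun s hs =>
      (hsep s hs).elim (fun h => Or.inr h.le) (fun h => Or.inl h.le)
    intro u hu v hv
    rw [Finset.mem_insert] at hu hv
    rcases hu with rfl | hu <;> rcases hv with rfl | hv
    · exact Or.inl le_rfl
    · exact (h1 v hv).symm
    · exact h1 u hu
    · exact hS u hu v hv
  · rintro T x ⟨⟨hc, hT⟩, hx⟩
    refine ⟨⟨?_, ?_⟩, ?_⟩
    · rw [Finset.card_erase_of_mem hx, hc, Nat.add_sub_cancel]
    · exact fun u hu v hv => hT u (Finset.mem_of_mem_erase hu) v (Finset.mem_of_mem_erase hv)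
    · intro s hs
      obtain ⟨hsx, hsT⟩ := Finset.mem_erase.1 hs
      rcases hT s hsT x hx with h | h
      · exact Or.inr (lt_of_le_of_ne h hsx)
      · exact Or.inl (lt_of_le_of_ne h (Ne.symm hsx))
  · rintro w S ⟨⟨hc, hS⟩, hsep⟩
    have hx : w 0 ∉ S := fun h => by simpa using hsep _ h
    rw [Finset.erase_insert hx]
    refine Prod.ext (funext fun a => ?_) rfl
    rw [Subsingleton.elim a 0]
  · rintro T x ⟨-, hx⟩
    rw [Finset.insert_erase hx]
  · rintro w S ⟨⟨hc, hS⟩, hsep⟩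
    have hx : w 0 ∉ S := fun h => by simpa using hsep _ h
    simp [pairWeight, hx]

theorem sum_alternating_telescope {R : Type*} [CommRing R] (F : ℕ → R) (n : ℕ) :
    ∑ i ∈ Finset.range n, (-1) ^ i * (F i + F (i + 1)) = F 0 - (-1) ^ n * F n := by
  induction n with
  | zero => simp
  | succ n ih =>
    rw [Finset.sum_range_succ, ih]
    ring

/-- Newton's identities hold with the sums over correct sequences in place of the power sums. -/
theorem newton_correctSum (k : ℕ) :
    ((k + 1 : ℕ) : MvPolynomial U ℝ) * gElem (incGraph U) (k + 1) = (-1) ^ k *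
      ∑ i ∈ Finset.range (k + 1), (-1) ^ i * (gElem (incGraph U) i * correctSum U (k - i + 1)) := by
  classical
  -- `F i` is the non-separated part of the `i`-th term. The separated part of that term is `F (i +
  -- 1)`, where the value at `k + 1` is the remainder from sequences of length one. The alternating
  -- sum telescopes.
  let F : ℕ → MvPolynomial U ℝ := fun i => if i ≤ k then
    ∑ p ∈ correctChainPairs U i (k - i + 1) with ¬ Separated p.1 p.2, pairWeight p
    else ((k + 1 : ℕ) : MvPolynomial U ℝ) * gElem (incGraph U) (k + 1)
  have hF : ∀ i ∈ Finset.range (k + 1),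
      (-1) ^ i * (gElem (incGraph U) i * correctSum U (k - i + 1))
        = (-1) ^ i * (F i + F (i + 1)) := by
    intro i hi
    have hi := Finset.mem_range.1 hi
    rw [gElem_mul_correctSum, ← Finset.sum_filter_not_add_sum_filter _ (fun p => Separated p.1 p.2)]
    congr 2
    · exact (if_pos (by omega)).symm
    · by_cases hik : i = k
      · subst hik
        rw [show F (i + 1) = _ from if_neg (by omega), Nat.sub_self, sum_separated_one]
      · obtain ⟨j, rfl⟩ : ∃ j, k = i + 1 + j := ⟨k - (i + 1), by omega⟩
        rw [show F (i + 1) = _ from if_pos (by omega), show i + 1 + j - i = j + 1 by omega,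
          show i + 1 + j - (i + 1) = j by omega, sum_not_separated]
  rw [Finset.sum_congr rfl hF, sum_alternating_telescope,
    -- The empty chain is separated from every sequence.
    show F 0 = 0 from (if_pos (Nat.zero_le _)).trans (sum_not_separated_zero _),
    show F (k + 1) = _ from if_neg (by omega), zero_sub, pow_succ]
  have h : ((-1 : MvPolynomial U ℝ) ^ k) * (-1) ^ k = 1 := by
    rw [← mul_pow]
    simp
  linear_combination (-((k + 1 : ℕ) : MvPolynomial U ℝ) * gElem (incGraph U) (k + 1)) * h

end Correct

/-! ### The images of `p_k` and `m_{l,1}` -/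

theorem elem_zero : elem 0 = 1 := by
  classical
  refine Subtype.ext ?_
  ext d
  rw [coeff_elem, OneMemClass.coe_one, MvPowerSeries.coeff_one]
  refine if_congr ?_ rfl rfl
  rw [Finsupp.degree_eq_zero_iff]
  refine ⟨fun h => h.1, ?_⟩
  rintro rfl
  simp

/-! ### Monomial positivity and the images under the `G`-homomorphism -/

theorem MonomialPositive.sum {V ι : Type*} {s : Finset ι} {f : ι → MvPolynomial V ℝ}
    (h : ∀ i ∈ s, MonomialPositive (f i)) : MonomialPositive (∑ i ∈ s, f i) := by
  intro α
  choose! k hk using fun i hi => h i hi α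
  refine ⟨∑ i ∈ s, k i, ?_⟩
  rw [MvPolynomial.coeff_sum, Nat.cast_sum]
  exact Finset.sum_congr rfl hk

theorem MonomialPositive.monomial {V : Type*} (d : V →₀ ℕ) :
    MonomialPositive (MvPolynomial.monomial d (1 : ℝ)) := by
  classical
  intro α
  refine ⟨if d = α then 1 else 0, ?_⟩
  rw [MvPolynomial.coeff_monomial]
  split_ifs <;> simp

theorem prod_X_eq_monomial {V ι : Type*} (s : Finset ι) (f : ι → V) :
    (∏ i ∈ s, MvPolynomial.X (f i) : MvPolynomial V ℝ)
      = MvPolynomial.monomial (∑ i ∈ s, Finsupp.single (f i) 1) 1 := by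
  rw [MvPolynomial.monomial_sum_one]
  rfl

section Image

variable {V : Type*} [Fintype V]

theorem gElem_zero (G : SimpleGraph V) : gElem G 0 = 1 := by
  classical
  rw [gElem, Finset.powersetCard_zero, Finset.filter_singleton, if_pos (by simp)]
  simp

theorem gHom_elem_eq_gElem (G : SimpleGraph V) (k : ℕ) : gHom G (elem k) = gElem G k := by
  rcases Nat.eq_zero_or_pos k with rfl | hk
  · rw [elem_zero, map_one, gElem_zero]
  · exact gHom_elem G hk

variable {U : Type*} [Fintype U] [PartialOrder U]

/-- Strong induction: in the two Newton identities all terms with `i > 0` agree by hypothesis, and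
the term `i = 0` is the sought one because `e_0 = 1`. -/
theorem gHom_powerSum (k : ℕ) : gHom (incGraph U) (powerSum (k + 1)) = correctSum U (k + 1) := by
  induction k using Nat.strong_induction_on with
  | _ k ih =>
    have h := congrArg (gHom (incGraph U)) (newton k)
    simp only [map_mul, map_pow, map_neg, map_one, map_sum, map_natCast, gHom_elem_eq_gElem] at h
    rw [newton_correctSum, Finset.sum_range_succ', Finset.sum_range_succ'] at h
    have h0 : (-1 : MvPolynomial U ℝ) ^ k ≠ 0 := pow_ne_zero _ (by simp)
    have h1 := mul_left_cancel₀ h0 h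
    rw [Finset.sum_congr rfl fun i hi => by
      rw [← ih (k - (i + 1)) (by have := Finset.mem_range.1 hi; omega)]] at h1
    have h2 := add_left_cancel h1
    simpa [gElem_zero] using h2.symm

theorem correctSum_one : correctSum U 1 = ∑ z, MvPolynomial.X z := by
  classical
  rw [correctSum, Finset.filter_true_of_mem fun w _ => isCorrect_one w]
  refine Fintype.sum_equiv (Equiv.funUnique (Fin 1) U) _ _ fun w => ?_
  simp

theorem gHom_mono_hookPart {l : ℕ} (hl : 2 ≤ l) :
    gHom (incGraph U) (mono (hookPart l (one_le_two.trans hl))) =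
      ∑ p ∈ pairs U l, (∏ i, MvPolynomial.X (p.1 i)) * MvPolynomial.X p.2 := by
  classical
  obtain ⟨j, rfl⟩ : ∃ j, l = j + 1 := ⟨l - 1, by omega⟩
  have h := congrArg (gHom (incGraph U)) (powerSum_mul_powerSum_one hl)
  rw [map_mul, map_add, gHom_powerSum, gHom_powerSum, gHom_powerSum, zero_add] at h
  have h1 : correctSum U (j + 1) * correctSum U 1
      = ∑ p : (Fin (j + 1) → U) × U with IsCorrect p.1,
        (∏ i, MvPolynomial.X (p.1 i)) * MvPolynomial.X p.2 := by
    rw [correctSum_one, correctSum, Finset.sum_mul_sum, ← Finset.sum_product']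
    refine Finset.sum_congr ?_ fun _ _ => rfl
    ext p
    simp
  have h2 : correctSum U (j + 1 + 1)
      = ∑ p : (Fin (j + 1) → U) × U with
          IsCorrect p.1 ∧ ¬ p.2 < p.1 (Fin.last j) ∧ ∃ i, ¬ p.1 i < p.2,
        (∏ i, MvPolynomial.X (p.1 i)) * MvPolynomial.X p.2 := by
    rw [correctSum]
    refine (Finset.sum_nbij' (fun p => (Fin.snoc p.1 p.2 : Fin (j + 2) → U))
      (fun w => ((Fin.init w : Fin (j + 1) → U), w (Fin.last (j + 1)))) ?_ ?_ ?_ ?_ ?_).symm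
    · intro p hp
      rw [Finset.mem_filter] at hp ⊢
      exact ⟨Finset.mem_univ _, (isCorrect_snoc _ _).2 hp.2⟩
    · intro w hw
      rw [Finset.mem_filter] at hw ⊢
      refine ⟨Finset.mem_univ _, (isCorrect_snoc _ _).1 ?_⟩
      rw [Fin.snoc_init_self]
      exact hw.2
    · intro p _
      simp
    · intro w _
      simp
    · intro p _
      simp [Fin.prod_univ_castSucc]
  -- The condition on `z` in `M_{l,1}` is the negation of the condition for appending `z` in
  -- `isCorrect_snoc`.
  have h3 : pairs U (j + 1) = Finset.univ.filter fun p : (Fin (j + 1) → U) × U =>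
      IsCorrect p.1 ∧ ¬ (¬ p.2 < p.1 (Fin.last j) ∧ ∃ i, ¬ p.1 i < p.2) := by
    ext p
    rw [pairs, Finset.mem_filter, Finset.mem_filter]
    have h4 : (∃ i : Fin (j + 1), (i : ℕ) + 1 = j + 1 ∧ p.2 < p.1 i) ↔ p.2 < p.1 (Fin.last j) := by
      constructor
      · rintro ⟨i, hi, h⟩
        rwa [show i = Fin.last j from Fin.ext (by simpa using hi)] at h
      · exact fun h => ⟨Fin.last j, rfl, h⟩
    rw [h4, not_and_or, not_not, not_exists]
    simp only [not_not]
    tauto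
  rw [h1, h2] at h
  rw [h3, ← add_right_inj, ← h]
  have h5 := Finset.sum_filter_add_sum_filter_not
    (Finset.univ.filter fun p : (Fin (j + 1) → U) × U => IsCorrect p.1)
    (fun p => ¬ p.2 < p.1 (Fin.last j) ∧ ∃ i, ¬ p.1 i < p.2)
    (fun p => (∏ i, MvPolynomial.X (p.1 i)) * MvPolynomial.X p.2 : _ → MvPolynomial U ℝ)
  rw [Finset.filter_filter, Finset.filter_filter] at h5
  exact h5.symm

theorem monomialPositive_mono_hookPart (l : ℕ) (hl : 1 ≤ l) :
    MonomialPositive (gHom (incGraph U) (mono (hookPart l hl))) := by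
  rcases hl.eq_or_lt with rfl | hl
  · rw [mono_hookPart_one, gHom_elem_eq_gElem, gElem]
    refine MonomialPositive.sum fun S _ => ?_
    rw [prod_X_eq_monomial]
    exact MonomialPositive.monomial _
  · rw [gHom_mono_hookPart hl]
    refine MonomialPositive.sum fun p _ => ?_
    rw [prod_X_eq_monomial, MvPolynomial.X, MvPolynomial.monomial_mul, one_mul]
    exact MonomialPositive.monomial _

end Image

/-! ### The `e`-coefficients of the chromatic symmetric function -/

theorem degree_eq_of_map_support {n : ℕ} {μ : n.Partition} {d : ℕ →₀ ℕ}
    (h : d.support.val.map d = μ.parts) : d.degree = n := by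
  rw [← μ.parts_sum, ← h]
  rfl

theorem exists_map_support_eq {n : ℕ} (μ : n.Partition) :
    ∃ d : ℕ →₀ ℕ, d.support.val.map d = μ.parts := by
  classical
  have key : ∀ s : Multiset ℕ, (∀ i ∈ s, 0 < i) → ∃ d : ℕ →₀ ℕ, d.support.val.map d = s := by
    intro s
    induction s using Multiset.induction_on with
    | empty => exact fun _ => ⟨0, rfl⟩
    | cons a s ih =>
      intro h
      obtain ⟨d, hd⟩ := ih fun i hi => h i (Multiset.mem_cons_of_mem hi)
      have ha : 0 < a := h a (Multiset.mem_cons_self _ _)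
      obtain ⟨k, hk⟩ := Infinite.exists_notMem_finset d.support
      refine ⟨d.update k a, ?_⟩
      rw [Finsupp.support_update_ne_zero d k ha.ne', Finset.insert_val_of_notMem hk,
        Multiset.map_cons, ← hd]
      congr 1
      · simp
      · refine Multiset.map_congr rfl fun i hi => ?_
        have hik : i ≠ k := by
          rintro rfl
          exact hk hi
        simp [Function.update_of_ne hik]
  exact key μ.parts fun i hi => μ.parts_pos hi

/-- A homogeneous symmetric function is determined by its coefficients on partitions. -/
theorem eq_sum_mono {n : ℕ} {f : Lam} (a : n.Partition → ℝ)
    (h0 : ∀ d : ℕ →₀ ℕ, d.degree ≠ n → MvPowerSeries.coeff d (f : MvPowerSeries ℕ ℝ) = 0)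
    (ha : ∀ (d : ℕ →₀ ℕ) (μ : n.Partition), d.support.val.map d = μ.parts →
      MvPowerSeries.coeff d (f : MvPowerSeries ℕ ℝ) = a μ) :
    f = ∑ μ, a μ • mono μ := by
  classical
  refine Subtype.ext ?_
  ext d
  rw [AddSubmonoidClass.coe_finsetSum, map_sum]
  simp only [SetLike.val_smul, map_smul, coeff_mono, smul_eq_mul, mul_ite, mul_one, mul_zero]
  by_cases hd : d.degree = n
  · let ν : n.Partition := ⟨d.support.val.map d, fun {i} hi => by
      obtain ⟨j, hj, rfl⟩ := Multiset.mem_map.1 hi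
      exact Nat.pos_of_ne_zero (Finsupp.mem_support_iff.1 hj), hd⟩
    rw [Finset.sum_eq_single ν, if_pos rfl, ha d ν rfl]
    · exact fun μ _ hμ => if_neg fun h => hμ (Nat.Partition.ext h.symm)
    · exact fun h => absurd (Finset.mem_univ _) h
  · rw [h0 d hd]
    exact (Finset.sum_eq_zero fun μ _ => if_neg fun h => hd (degree_eq_of_map_support h)).symm

/-- The product of the `e_{d_i}`. -/
noncomputable def elemExp (d : ℕ →₀ ℕ) : Lam := ∏ i ∈ d.support, elem (d i)

theorem elemPart_eq_elemExp {n : ℕ} {μ : n.Partition} {d : ℕ →₀ ℕ}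
    (h : d.support.val.map d = μ.parts) : elemPart μ = elemExp d := by
  rw [elemPart, ← h, Multiset.map_map]
  rfl

/-! ### Zero-one matrices and the transition from `e` to `m` -/

/-- The zero-one matrices (given by the positions of the ones) with given row and column sums. -/
def binaryMatrices (r c : ℕ →₀ ℕ) : Set (Finset (ℕ × ℕ)) :=
  {B | (∀ i, (B.filter fun p => p.1 = i).card = r i) ∧
    ∀ j, (B.filter fun p => p.2 = j).card = c j}

theorem ncard_binaryMatrices_comm (r c : ℕ →₀ ℕ) :
    (binaryMatrices r c).ncard = (binaryMatrices c r).ncard := by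
  have hswap : ∀ r c : ℕ →₀ ℕ, ∀ B ∈ binaryMatrices r c,
      B.map (Equiv.prodComm ℕ ℕ).toEmbedding ∈ binaryMatrices c r := by
    rintro r c B ⟨h1, h2⟩
    refine ⟨fun i => ?_, fun j => ?_⟩
    · rw [Finset.filter_map, Finset.card_map, ← h2 i]
      rfl
    · rw [Finset.filter_map, Finset.card_map, ← h1 j]
      rfl
  refine Set.ncard_congr (fun B _ => B.map (Equiv.prodComm ℕ ℕ).toEmbedding) (hswap r c) ?_ ?_
  · intro B B' _ _ h
    exact Finset.map_injective _ h
  · intro B hB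
    refine ⟨_, hswap c r B hB, ?_⟩
    ext ⟨i, j⟩
    simp

/-- Both degrees count the ones of the matrix. -/
theorem degree_eq_of_mem_binaryMatrices {r c : ℕ →₀ ℕ} {B : Finset (ℕ × ℕ)}
    (hB : B ∈ binaryMatrices r c) : r.degree = c.degree := by
  trans B.card
  · rw [Finsupp.degree_apply, Finset.card_eq_sum_card_fiberwise (f := Prod.fst) (t := r.support)]
    · exact Finset.sum_congr rfl fun i _ => (hB.1 i).symm
    · intro p hp
      rw [Finset.mem_coe, Finsupp.mem_support_iff, ← hB.1]
      exact Finset.card_ne_zero_of_mem (Finset.mem_filter.2 ⟨hp, rfl⟩)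
  · rw [Finsupp.degree_apply, Finset.card_eq_sum_card_fiberwise (f := Prod.snd) (t := c.support)]
    · exact Finset.sum_congr rfl fun i _ => hB.2 i
    · intro p hp
      rw [Finset.mem_coe, Finsupp.mem_support_iff, ← hB.2]
      exact Finset.card_ne_zero_of_mem (Finset.mem_filter.2 ⟨hp, rfl⟩)

/-- The rows of a zero-one matrix. -/
noncomputable def rows (B : Finset (ℕ × ℕ)) : ℕ →₀ (ℕ →₀ ℕ) :=
  ∑ p ∈ B, Finsupp.single p.1 (Finsupp.single p.2 1)

theorem rows_apply (B : Finset (ℕ × ℕ)) (i : ℕ) :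
    rows B i = ∑ p ∈ B with p.1 = i, Finsupp.single p.2 1 := by
  rw [rows, Finsupp.finsetSum_apply, Finset.sum_filter]
  simp only [Finsupp.single_apply]

theorem rows_apply_apply (B : Finset (ℕ × ℕ)) (i j : ℕ) :
    rows B i j = if (i, j) ∈ B then 1 else 0 := by
  rw [rows_apply, Finsupp.finsetSum_apply, Finset.sum_filter]
  have h : ∀ p : ℕ × ℕ, (p.1 = i ∧ p.2 = j) ↔ p = (i, j) :=
    fun p => (Prod.ext_iff (x := p) (y := (i, j))).symm
  simp only [Finsupp.single_apply, ← ite_and, h, Finset.sum_ite_eq']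

theorem degree_rows (B : Finset (ℕ × ℕ)) (i : ℕ) :
    (rows B i).degree = (B.filter fun p => p.1 = i).card := by
  rw [rows_apply, map_sum]
  simp

theorem rows_injective : Function.Injective rows := by
  intro B B' h
  ext ⟨i, j⟩
  have h1 := DFunLike.congr_fun (DFunLike.congr_fun h i) j
  rw [rows_apply_apply, rows_apply_apply] at h1
  split_ifs at h1 <;> simp_all

theorem sum_rows (B : Finset (ℕ × ℕ)) (s : Finset ℕ) (hs : ∀ p ∈ B, p.1 ∈ s) (j : ℕ) :
    (∑ i ∈ s, rows B i) j = (B.filter fun p => p.2 = j).card := by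
  have h : ∑ i ∈ s, rows B i = ∑ p ∈ B, Finsupp.single p.2 1 := by
    simp only [rows, Finsupp.finsetSum_apply]
    rw [Finset.sum_comm]
    refine Finset.sum_congr rfl fun p hp => ?_
    simp [Finsupp.single_apply, hs p hp]
  rw [h, Finsupp.finsetSum_apply, Finset.card_filter]
  simp only [Finsupp.single_apply]

/-- The right-hand side is the index set that arises when the coefficient of a product of elementary
functions is expanded: row `i` is the squarefree monomial chosen from the factor `e_{r_i}`. -/
theorem mem_binaryMatrices_iff (r c : ℕ →₀ ℕ) (B : Finset (ℕ × ℕ)) :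
    B ∈ binaryMatrices r c ↔ rows B ∈ Finset.finsuppAntidiag r.support c ∧
      ∀ i ∈ r.support, (rows B i).degree = r i ∧ ∀ j, rows B i j ≤ 1 := by
  rw [Finset.mem_finsuppAntidiag]
  constructor
  · rintro ⟨h1, h2⟩
    have hs : ∀ p ∈ B, p.1 ∈ r.support := by
      intro p hp
      rw [Finsupp.mem_support_iff, ← h1]
      exact Finset.card_ne_zero_of_mem (Finset.mem_filter.2 ⟨hp, rfl⟩)
    refine ⟨⟨?_, ?_⟩, fun i _ => ⟨?_, fun j => ?_⟩⟩
    · ext j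
      rw [sum_rows B _ hs, h2]
    · intro i hi
      rw [Finsupp.mem_support_iff, ne_eq, ← Finsupp.degree_eq_zero_iff, degree_rows, h1] at hi
      exact Finsupp.mem_support_iff.2 hi
    · rw [degree_rows, h1]
    · rw [rows_apply_apply]
      split_ifs <;> simp
  · rintro ⟨⟨h1, h2⟩, h3⟩
    have hs : ∀ p ∈ B, p.1 ∈ r.support := by
      intro p hp
      refine h2 (Finsupp.mem_support_iff.2 fun h => ?_)
      have h4 := rows_apply_apply B p.1 p.2
      rw [h, if_pos hp] at h4
      simp at h4
    refine ⟨fun i => ?_, fun j => ?_⟩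
    · rw [← degree_rows]
      by_cases hi : i ∈ r.support
      · exact (h3 i hi).1
      · rw [Finsupp.notMem_support_iff.1 hi, Finsupp.degree_eq_zero_iff]
        exact Finsupp.notMem_support_iff.1 fun h => hi (h2 h)
    · rw [← sum_rows B _ hs, h1]

theorem coeff_elemExp (r c : ℕ →₀ ℕ) :
    MvPowerSeries.coeff c (elemExp r : MvPowerSeries ℕ ℝ) = ((binaryMatrices r c).ncard : ℝ) := by
  classical
  have h : (elemExp r : MvPowerSeries ℕ ℝ)
      = ∏ i ∈ r.support, (elem (r i) : MvPowerSeries ℕ ℝ) := by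
    rw [elemExp, SubmonoidClass.coe_finsetProd]
  rw [h, MvPowerSeries.coeff_prod]
  simp only [coeff_elem, Finset.prod_ite_zero, Finset.prod_const_one]
  rw [Finset.sum_boole, ← Set.ncard_coe_finset]
  congr 1
  symm
  refine Set.ncard_congr (fun B _ => rows B) ?_ ?_ ?_
  · intro B hB
    rw [Finset.mem_coe, Finset.mem_filter]
    exact (mem_binaryMatrices_iff r c B).1 hB
  · intro B B' _ _ h
    exact rows_injective h
  · intro l hl
    rw [Finset.mem_coe, Finset.mem_filter] at hl
    -- The entries of `l` are `0` or `1`, so `l` is recovered from the positions of its nonzero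
    -- entries.
    have hB : rows l.uncurry.support = l := by
      ext i j
      rw [rows_apply_apply]
      simp only [Finsupp.mem_support_iff, Finsupp.uncurry_apply_pair]
      split_ifs with h
      · by_cases hi : i ∈ r.support
        · have := (hl.2 i hi).2 j
          omega
        · refine absurd ?_ h
          rw [Finsupp.notMem_support_iff.1 fun h =>
            hi ((Finset.mem_finsuppAntidiag.1 hl.1).2 h), Finsupp.coe_zero, Pi.zero_apply]
      · exact (not_not.1 h).symm
    refine ⟨l.uncurry.support, ?_, hB⟩
    rw [mem_binaryMatrices_iff, hB]
    exact hl

theorem coeff_elemExp_comm (r c : ℕ →₀ ℕ) :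
    MvPowerSeries.coeff c (elemExp r : MvPowerSeries ℕ ℝ)
      = MvPowerSeries.coeff r (elemExp c : MvPowerSeries ℕ ℝ) := by
  rw [coeff_elemExp, coeff_elemExp, ncard_binaryMatrices_comm]

theorem coeff_elemExp_of_degree_ne {r c : ℕ →₀ ℕ} (h : c.degree ≠ r.degree) :
    MvPowerSeries.coeff c (elemExp r : MvPowerSeries ℕ ℝ) = 0 := by
  rw [coeff_elemExp, Set.eq_empty_iff_forall_notMem.2 fun B hB =>
    h (degree_eq_of_mem_binaryMatrices hB).symm]
  simp

/-- The transition matrix from monomial to elementary symmetric functions is symmetric. -/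
theorem exists_symmetric_transition (n : ℕ) : ∃ M : n.Partition → n.Partition → ℝ,
    (∀ μ ν, M μ ν = M ν μ) ∧ ∀ μ, elemPart μ = ∑ ν, M μ ν • mono ν := by
  choose rep hrep using fun μ : n.Partition => exists_map_support_eq μ
  refine ⟨fun μ ν => MvPowerSeries.coeff (rep ν) (elemExp (rep μ) : MvPowerSeries ℕ ℝ),
    fun μ ν => coeff_elemExp_comm _ _, fun μ => eq_sum_mono _ (fun d hd => ?_) fun d ν hν => ?_⟩
  · rw [elemPart_eq_elemExp (hrep μ)]
    refine coeff_elemExp_of_degree_ne ?_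
    rwa [degree_eq_of_map_support (hrep μ)]
  -- Independence of the representative comes from using the symmetry twice: after the first swap
  -- `d` only enters through the product `e_ν`, where it may be replaced by `rep ν`.
  · rw [elemPart_eq_elemExp (hrep μ), coeff_elemExp_comm, ← elemPart_eq_elemExp hν,
      elemPart_eq_elemExp (hrep ν), coeff_elemExp_comm]

/-! ### Colorings as tuples of stable sets -/

section Chromatic

variable {V : Type*} [Fintype V] (G : SimpleGraph V)

/-- The coefficient of `∏_{v ∈ V} v` in the image under the `G`-homomorphism. -/
noncomputable def squarefreeCoeff : Lam →ₗ[ℝ] ℝ :=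
  MvPolynomial.lcoeff ℝ (∑ v : V, Finsupp.single v 1) ∘ₗ (gHom G).toLinearMap

theorem squarefreeCoeff_apply (f : Lam) :
    squarefreeCoeff G f = MvPolynomial.coeff (∑ v : V, Finsupp.single v 1) (gHom G f) := rfl

theorem sum_single_one_apply {ι : Type*} [DecidableEq ι] (s : Finset ι) (v : ι) :
    (∑ u ∈ s, Finsupp.single u 1 : ι →₀ ℕ) v = if v ∈ s then 1 else 0 := by
  rw [Finsupp.finsetSum_apply]
  simp [Finsupp.single_apply]

theorem colorExp_apply [DecidableEq V] (c : V → ℕ) (i : ℕ) :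
    colorExp c i = (Finset.univ.filter fun v => c v = i).card := by
  rw [colorExp, Finsupp.finsetSum_apply, Finset.card_filter]
  simp only [Finsupp.single_apply]

theorem degree_colorExp (c : V → ℕ) : (colorExp c).degree = Fintype.card V := by
  rw [colorExp, map_sum]
  simp

theorem coeff_chromatic (d : ℕ →₀ ℕ) :
    MvPowerSeries.coeff d (chromatic G : MvPowerSeries ℕ ℝ)
      = ({c : G.Coloring ℕ | colorExp c = d}.ncard : ℝ) := rfl

/-- Expanding `∏ e_{d_i}^G` gives tuples of stable sets of sizes `d_i`. The monomial `∏ v` selects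
the tuples covering each vertex exactly once, and these are the color classes of the proper
colorings with exponent vector `d`. -/
theorem coeff_chromatic_eq_squarefreeCoeff (d : ℕ →₀ ℕ) :
    MvPowerSeries.coeff d (chromatic G : MvPowerSeries ℕ ℝ) = squarefreeCoeff G (elemExp d) := by
  classical
  rw [coeff_chromatic, squarefreeCoeff_apply, elemExp, map_prod, ← Finset.prod_coe_sort]
  simp only [gHom_elem_eq_gElem, gElem]
  rw [Finset.prod_univ_sum, MvPolynomial.coeff_sum]
  have hmon : ∀ S : d.support → Finset V, (∏ i, ∏ v ∈ S i, MvPolynomial.X v : MvPolynomial V ℝ)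
      = MvPolynomial.monomial (∑ i, ∑ u ∈ S i, Finsupp.single u 1) 1 := by
    intro S
    rw [MvPolynomial.monomial_sum_one]
    exact Finset.prod_congr rfl fun i _ => prod_X_eq_monomial _ _
  simp only [hmon, MvPolynomial.coeff_monomial]
  rw [Finset.sum_boole, ← Set.ncard_coe_finset]
  congr 1
  have hsum : ∀ (S : d.support → Finset V) (v : V),
      (∑ i, ∑ u ∈ S i, Finsupp.single u 1 : V →₀ ℕ) v
        = (Finset.univ.filter fun i => v ∈ S i).card := by
    intro S v
    rw [Finsupp.finsetSum_apply, Finset.card_filter]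
    simp only [sum_single_one_apply]
  have hmem : ∀ S : d.support → Finset V,
      S ∈ ({S ∈ Fintype.piFinset fun i : d.support => (Finset.powersetCard (d i) Finset.univ).filter
          fun S : Finset V => G.IsIndepSet ↑S |
        (∑ i, ∑ u ∈ S i, Finsupp.single u 1 : V →₀ ℕ) = ∑ v : V, Finsupp.single v 1} : Finset _)
      ↔ (∀ i, (S i).card = d i ∧ G.IsIndepSet ↑(S i)) ∧
        ∀ v, (Finset.univ.filter fun i => v ∈ S i).card = 1 := by
    intro S
    rw [Finset.mem_filter, Fintype.mem_piFinset, DFunLike.ext_iff]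
    simp only [hsum, sum_single_one_apply, Finset.mem_filter, Finset.mem_powersetCard_univ,
      Finset.mem_univ, if_true]
  refine Set.ncard_congr (fun c _ i => Finset.univ.filter fun v => c v = i) ?_ ?_ ?_
  · rintro c rfl
    rw [Finset.mem_coe, hmem]
    refine ⟨fun i => ⟨(colorExp_apply _ _).symm, ?_⟩, fun v => ?_⟩
    · intro u hu v hv _ huv
      simp only [Finset.coe_filter, Finset.mem_univ, true_and, Set.mem_ofPred_eq] at hu hv
      exact c.valid huv (hu.trans hv.symm)
    · have hv : c v ∈ (colorExp c).support := by
        rw [Finsupp.mem_support_iff, colorExp_apply]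
        exact Finset.card_ne_zero_of_mem (Finset.mem_filter.2 ⟨Finset.mem_univ v, rfl⟩)
      rw [Finset.card_eq_one]
      refine ⟨⟨c v, hv⟩, ?_⟩
      ext i
      simp [Subtype.ext_iff, eq_comm]
  · rintro c c' rfl _ h
    refine DFunLike.ext _ _ fun v => ?_
    have hv : c v ∈ (colorExp c).support := by
      rw [Finsupp.mem_support_iff, colorExp_apply]
      exact Finset.card_ne_zero_of_mem (Finset.mem_filter.2 ⟨Finset.mem_univ v, rfl⟩)
    have h1 := Finset.ext_iff.1 (congrFun h ⟨c v, hv⟩) v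
    simp only [Finset.mem_filter, Finset.mem_univ, true_and, true_iff] at h1
    exact h1.symm
  · intro S hS
    rw [Finset.mem_coe, hmem] at hS
    obtain ⟨h1, h2⟩ := hS
    -- The color of `v` is the index of the unique set containing it.
    choose c hc using fun v => Finset.card_eq_one.1 (h2 v)
    have hcS : ∀ v i, v ∈ S i ↔ c v = i := by
      intro v i
      have := Finset.ext_iff.1 (hc v) i
      simp only [Finset.mem_filter, Finset.mem_univ, true_and, Finset.mem_singleton] at this
      rw [this, eq_comm]
    have hfilter : ∀ i : d.support, (Finset.univ.filter fun v => (c v : ℕ) = i) = S i := by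
      intro i
      ext v
      rw [Finset.mem_filter, hcS, Subtype.ext_iff]
      exact and_iff_right (Finset.mem_univ v)
    refine ⟨SimpleGraph.Coloring.mk (fun v => (c v : ℕ)) fun {u v} huv h => ?_, ?_, ?_⟩
    · have h' : c v = c u := Subtype.ext h.symm
      exact (h1 (c u)).2 ((hcS u _).2 rfl) ((hcS v _).2 h') huv.ne huv
    · change colorExp (fun v => (c v : ℕ)) = d
      ext i
      rw [colorExp_apply]
      by_cases hi : i ∈ d.support
      · rw [hfilter ⟨i, hi⟩, (h1 ⟨i, hi⟩).1]
      · rw [Finsupp.notMem_support_iff.1 hi, Finset.card_eq_zero, Finset.filter_eq_empty_iff]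
        rintro v - rfl
        exact hi (c v).2
    · exact funext hfilter

theorem chromatic_eq_sum_mono :
    chromatic G = ∑ μ : (Fintype.card V).Partition, squarefreeCoeff G (elemPart μ) • mono μ := by
  refine eq_sum_mono _ (fun d hd => ?_) fun d μ h => ?_
  · have h : {c : G.Coloring ℕ | colorExp c = d} = ∅ :=
      Set.eq_empty_iff_forall_notMem.2 fun c hc => hd (by
        rw [← show colorExp c = d from hc, degree_colorExp])
    rw [coeff_chromatic, h, Set.ncard_empty, Nat.cast_zero]
  · rw [elemPart_eq_elemExp h, coeff_chromatic_eq_squarefreeCoeff]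

/-- Expand `e_μ` inside the linear functional, exchange the two sums, and use the symmetry of `M` to
reassemble `∑ M ν μ m_μ` into `e_ν`. -/
theorem chromatic_eq_sum_elemPart :
    chromatic G = ∑ μ : (Fintype.card V).Partition, squarefreeCoeff G (mono μ) • elemPart μ := by
  obtain ⟨M, hM, hE⟩ := exists_symmetric_transition (Fintype.card V)
  rw [chromatic_eq_sum_mono]
  simp only [hE, map_sum, map_smul, Finset.sum_smul, Finset.smul_sum, smul_smul]
  rw [Finset.sum_comm]
  refine Finset.sum_congr rfl fun μ _ => Finset.sum_congr rfl fun ν _ => ?_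
  rw [hM, mul_comm, smul_eq_mul]

/-- The coefficient of `e_μ` in `X_G` is the coefficient of `∏_{v ∈ V} v` in `m_μ^G`. -/
theorem eCoeff_eq_squarefreeCoeff {n : ℕ} (hn : Fintype.card V = n) (μ : n.Partition) :
    eCoeff G μ = squarefreeCoeff G (mono μ) := by
  classical
  subst hn
  rw [eCoeff, chromatic_eq_sum_elemPart]
  simp only [← elemBasis_apply, map_sum, map_smul, Module.Basis.repr_self]
  rw [Finsupp.finsetSum_apply, Finset.sum_eq_single μ]
  · simp
  · intro ν _ h
    simp [h]
  · exact fun h => absurd (Finset.mem_univ _) h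

theorem MonomialPositive.coeff_nonneg {V : Type*} {f : MvPolynomial V ℝ} (hf : MonomialPositive f)
    (α : V →₀ ℕ) : 0 ≤ MvPolynomial.coeff α f := by
  obtain ⟨k, hk⟩ := hf α
  rw [hk]
  exact Nat.cast_nonneg k

end Chromatic

end ChromaticSymm

open ChromaticSymm in
theorem mainTheorem6 {U : Type*} [Fintype U] [PartialOrder U] (hU : IsUnitIntervalOrder U) :
    (∀ (l : ℕ) (hl : 2 ≤ l),
      gHom (incGraph U) (mono (hookPart l (by omega))) =
        ∑ p ∈ pairs U l, (∏ i, MvPolynomial.X (p.1 i)) * MvPolynomial.X p.2) ∧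
    (∀ (l : ℕ) (hl : 1 ≤ l),
      MonomialPositive (gHom (incGraph U) (mono (hookPart l hl)))) ∧
    (∀ (l : ℕ) (hl : 1 ≤ l), Fintype.card U = l + 1 →
      0 ≤ eCoeff (incGraph U) (hookPart l hl)) := by
  refine ⟨fun l hl => gHom_mono_hookPart hl, monomialPositive_mono_hookPart, fun l hl hc => ?_⟩
  rw [eCoeff_eq_squarefreeCoeff _ hc]
  exact (monomialPositive_mono_hookPart l hl).coeff_nonneg _
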